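/- Let $P_1(\lambda),\dots,P_k(\lambda)$ be polynomial matrices with $P_i(\lambda)\in\mathbb{C}[\lambda]^{m_i\times n}$, let $m=\sum_i m_i$, and let $P(\lambda)=P_0+P_1\lambda+\dots+P_d\lambda^d\in\mathbb{C}[\lambda]^{m\times n}$ (here the $P_j\in\mathbb{C}^{m\times n}$ are constant coefficient matrices) be the compound matrix obtained by stacking the blocks $P_i(\lambda)$ vertically. Assume that $P_0$ has full column rank $n$. Put $$A=\begin{bmatrix}0&I_n&&\\&\ddots&\ddots&\\&&0&I_n\\&&&0\end{bmatrix}\in\mathbb{C}^{dn\times dn},\quad B=\begin{bmatrix}0\\\vdots\\0\\I_n\end{bmatrix}\in\mathbb{C}^{dn\times n},\quad C=[P_d\ \cdots\ P_1],\quad D=P_0,\quad S(\mu)=\begin{bmatrix}\mu I_{dn}-A&-B\\C&D\end{bmatrix},$$ so that $P(1/\mu)=C(\mu I_{dn}-A)^{-1}B+D$. By a *feedback decomposition* we mean a unitary matrix $U\in\mathbb{C}^{dn\times dn}$ and a matrix $F\in\mathbb{C}^{n\times dn}$ such that $$\begin{bmatrix}U^*&0\\0&I_m\end{bmatrix}S(\mu)\begin{bmatrix}U&0\\F&I_n\end{bmatrix}=\begin{bmatrix}\mu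 I_{d_f}-\hat A_{11}&-\tilde A_{12}&-B_1\\0&\mu I_{d_0}-\tilde A_{22}&-B_2\\0&\tilde C_2&D\end{bmatrix},$$ where $d_f+d_0=dn$, the eigenvalues of the $d_f\times d_f$ matrix $\hat A_{11}$ are exactly the finite eigenvalues of $S(\mu)$ counted with multiplicity (the roots of the invariant polynomials of its Smith form), and the $d_0\times d_0$ matrix $\tilde A_{22}$ is nilpotent. (i) A feedback decomposition exists, and it can be chosen with $\tilde A_{22}^d=0$. (ii) For every feedback decomposition, $I_{d_0}-\lambda\tilde A_{22}$ and $I_{dn}-\lambda A$ are invertible over $\mathbb{C}[\lambda]$, and $$P(\lambda)=N(\lambda)G(\lambda),\qquad N(\lambda)=D+\tilde C_2(I_{d_0}-\lambda\tilde A_{22})^{-1}\lambda B_2,\qquad G(\lambda)=I_n-FU^*(I_{dn}-\lambda A)^{-1}\lambda B,$$ where $N(\lambda)\in\mathbb{C}[\lambda]^{m\times n}$ is left invertible over $\mathbb{C}[\lambda]$ and $G(\lambda)\in\mathbb{C}[\lambda]^{n\times n}$ is a greatest common right divisor (GCRD) of the blocks $P_1(\lambda),\dots,P_k(\lambda)$;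 that is, $G$ is a right divisor of every block, and every common right divisor of the blocks, with any number of rows, is a right divisor of $G$. (iii) For every feedback decomposition, write $FU^*=[F_d\ \cdots\ F_1]$ with $n\times n$ blocks. Then $G(\lambda)=\sum_{i=0}^dG_i\lambda^i$ with $G_0=I_n$ and $G_i=-F_i$ for $i=1,\dots,d$. Moreover $N(\lambda)=\sum_{i\ge0}N_i\lambda^i$ with $N_0=P_0$ and $N_i=\tilde C_2\tilde A_{22}^{\,i-1}B_2$ for all $i\ge1$. If $\tilde A_{22}^d=0$, in particular for a decomposition as in (i), then $N_i=0$ for $i>d$, so that $N(\lambda)=\sum_{i=0}^dN_i\lambda^i$. -/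

import Mathlib

open Polynomial Matrix

namespace FeedbackGCRD

noncomputable section

/-- A constant matrix seen as a polynomial matrix. -/
abbrev constM {a b : Type*} (M : Matrix a b ℂ) : Matrix a b ℂ[X] := M.map Polynomial.C

/-- The coefficient matrix of the `j`-th power of the variable in a polynomial matrix. -/
def coeffM {a b : Type*} (M : Matrix a b ℂ[X]) (j : ℕ) : Matrix a b ℂ :=
  M.map fun p => p.coeff j

/-- The compound matrix obtained by stacking the blocks `P₁, …, P_k` vertically. -/
def compound {k n : ℕ} {m : Fin k → ℕ} (P : (i : Fin k) → Matrix (Fin (m i)) (Fin n) ℂ[X]) :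
    Matrix (Σ i, Fin (m i)) (Fin n) ℂ[X] :=
  Matrix.of fun r j => P r.1 r.2 j

/-- `D` is a common right divisor of the family `P`. -/
def IsCRD {k n p : ℕ} {m : Fin k → ℕ} (P : (i : Fin k) → Matrix (Fin (m i)) (Fin n) ℂ[X])
    (D : Matrix (Fin p) (Fin n) ℂ[X]) : Prop :=
  ∀ i, ∃ Q : Matrix (Fin (m i)) (Fin p) ℂ[X], P i = Q * D

/-- `G` is a greatest common right divisor of the family `P`: it is a common right divisor,
and every common right divisor (with any number of rows) is a right divisor of it. -/
def IsGCRD {k n l : ℕ} {m : Fin k → ℕ} (P : (i : Fin k) → Matrix (Fin (m i)) (Fin n) ℂ[X])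
    (G : Matrix (Fin l) (Fin n) ℂ[X]) : Prop :=
  IsCRD P G ∧ ∀ (p : ℕ) (D : Matrix (Fin p) (Fin n) ℂ[X]), IsCRD P D →
    ∃ Q : Matrix (Fin l) (Fin p) ℂ[X], G = Q * D

/-- Left invertibility over the ring of polynomials. -/
def IsLeftInvertible {a b : Type*} [Fintype a] [DecidableEq b] (N : Matrix a b ℂ[X]) : Prop :=
  ∃ L : Matrix b a ℂ[X], L * N = 1

/-- The matrix with entry `s t` at position `(a t, b t)` for each `t`, and zeros elsewhere.
As `a` and `b` are injective, this is a Smith matrix up to a permutation of rows and of columns. -/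
def smithMatrix {R K : Type*} [DecidableEq R] [DecidableEq K] {r : ℕ}
    (s : Fin r → ℂ[X]) (a : Fin r ↪ R) (b : Fin r ↪ K) : Matrix R K ℂ[X] :=
  Matrix.of fun i j => ∑ t, if a t = i ∧ b t = j then s t else 0

/-- `s₁ ∣ s₂ ∣ … ∣ s_r` (all monic) are the diagonal entries of the Smith normal form of `M`. -/
def HasInvariantPolynomials {R K : Type*} [Fintype R] [DecidableEq R] [Fintype K] [DecidableEq K]
    (M : Matrix R K ℂ[X]) {r : ℕ} (s : Fin r → ℂ[X]) : Prop :=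
  (∀ t, (s t).Monic) ∧ (∀ t t', t ≤ t' → s t ∣ s t') ∧
    ∃ (a : Fin r ↪ R) (b : Fin r ↪ K) (V : Matrix R R ℂ[X]) (W : Matrix K K ℂ[X]),
      IsUnit V.det ∧ IsUnit W.det ∧ M = V * smithMatrix s a b * W

/-- The eigenvalues of the square matrix `A` are exactly the finite eigenvalues of the polynomial
matrix `M` (the roots of its invariant polynomials), counted with multiplicities: both
multisets consist of the roots of the same monic polynomial. -/
def HasFiniteEigenvaluesOf {q : ℕ} {R K : Type*} [Fintype R] [DecidableEq R] [Fintype K]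
    [DecidableEq K] (A : Matrix (Fin q) (Fin q) ℂ) (M : Matrix R K ℂ[X]) : Prop :=
  ∃ (r : ℕ) (s : Fin r → ℂ[X]), HasInvariantPolynomials M s ∧ A.charpoly = ∏ t, s t

/-- The `dn × dn` block shift: identity blocks on the first block superdiagonal. -/
def stateA (d n : ℕ) : Matrix (Fin d × Fin n) (Fin d × Fin n) ℂ :=
  Matrix.of fun x y => if (x.1 : ℕ) + 1 = (y.1 : ℕ) ∧ x.2 = y.2 then 1 else 0

/-- The `dn × n` matrix with blocks `0, …, 0, I`. -/
def stateB (d n : ℕ) : Matrix (Fin d × Fin n) (Fin n) ℂ :=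
  Matrix.of fun x j => if (x.1 : ℕ) + 1 = d ∧ x.2 = j then 1 else 0

/-- The block row `[P_d, …, P_2, P_1]` of coefficients of `P`. -/
def stateC {R : Type*} {n : ℕ} (d : ℕ) (P : Matrix R (Fin n) ℂ[X]) :
    Matrix R (Fin d × Fin n) ℂ :=
  Matrix.of fun x y => coeffM P (d - (y.1 : ℕ)) x y.2

/-- The system matrix `[μ I - A, -B; C, P_0]` of `P (1 / μ)`. -/
def systemMatrix {R : Type*} {n : ℕ} (d : ℕ) (P : Matrix R (Fin n) ℂ[X]) :
    Matrix ((Fin d × Fin n) ⊕ R) ((Fin d × Fin n) ⊕ Fin n) ℂ[X] :=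
  fromBlocks (charmatrix (stateA d n)) (-constM (stateB d n))
    (constM (stateC d P)) (constM (coeffM P 0))

/-- The feedback decomposition of the system matrix: `U` is unitary (its columns are split into
two groups of sizes `df` and `d0`), the transformed system matrix is block triangular, `A11`
has as its eigenvalues the finite eigenvalues of the system matrix, and `A22` has all its
eigenvalues at zero. The feedback `F` is expressed in the transformed state coordinates. -/
structure IsFeedbackDecomposition {R : Type*} [Fintype R] [DecidableEq R] {n df d0 : ℕ} (d : ℕ)
    (P : Matrix R (Fin n) ℂ[X])
    (U : Matrix (Fin d × Fin n) (Fin df ⊕ Fin d0) ℂ)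
    (F : Matrix (Fin n) (Fin df ⊕ Fin d0) ℂ)
    (A11 : Matrix (Fin df) (Fin df) ℂ) (A12 : Matrix (Fin df) (Fin d0) ℂ)
    (A22 : Matrix (Fin d0) (Fin d0) ℂ)
    (B1 : Matrix (Fin df) (Fin n) ℂ) (B2 : Matrix (Fin d0) (Fin n) ℂ)
    (C2 : Matrix R (Fin d0) ℂ) : Prop where
  unitary_left : Uᴴ * U = 1
  unitary_right : U * Uᴴ = 1
  decomp :
    (fromBlocks (constM Uᴴ) 0 0 1 : Matrix ((Fin df ⊕ Fin d0) ⊕ R) ((Fin d × Fin n) ⊕ R) ℂ[X]) *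
        systemMatrix d P *
        (fromBlocks (constM U) 0 (constM F) 1 :
          Matrix ((Fin d × Fin n) ⊕ Fin n) ((Fin df ⊕ Fin d0) ⊕ Fin n) ℂ[X]) =
      fromBlocks
        (fromBlocks (charmatrix A11) (-constM A12) 0 (charmatrix A22))
        (fromRows (-constM B1) (-constM B2))
        (fromCols 0 (constM C2))
        (constM (coeffM P 0))
  eigenvalues : HasFiniteEigenvaluesOf A11 (systemMatrix d P)
  nilpotent : IsNilpotent A22

/-- `N(λ) = P_0 + C2 (I - λ A22)⁻¹ λ B2`, computed over the ring of polynomials. -/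
def factorN {R : Type*} {n d0 : ℕ} (P0 : Matrix R (Fin n) ℂ)
    (A22 : Matrix (Fin d0) (Fin d0) ℂ) (B2 : Matrix (Fin d0) (Fin n) ℂ)
    (C2 : Matrix R (Fin d0) ℂ) : Matrix R (Fin n) ℂ[X] :=
  constM P0 + constM C2 * (1 - (X : ℂ[X]) • constM A22)⁻¹ * ((X : ℂ[X]) • constM B2)

/-- `G(λ) = I - K (I - λ A)⁻¹ λ B`, computed over the ring of polynomials, for a feedback `K`
expressed in the original state coordinates. -/
def factorG {d n : ℕ} (K : Matrix (Fin n) (Fin d × Fin n) ℂ) : Matrix (Fin n) (Fin n) ℂ[X] :=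
  1 - constM K * (1 - (X : ℂ[X]) • constM (stateA d n))⁻¹ * ((X : ℂ[X]) • constM (stateB d n))

/-- The `n × n` blocks of `K = [K_d, …, K_1]`; `feedbackBlock K i` is `K_{i+1}`. -/
def feedbackBlock {d n : ℕ} (K : Matrix (Fin n) (Fin d × Fin n) ℂ) (i : Fin d) :
    Matrix (Fin n) (Fin n) ℂ :=
  Matrix.of fun x y => K x (i.rev, y)

end

end FeedbackGCRD

open FeedbackGCRD

/-! Existence. Let `D' * D = 1`, where `D` is the constant coefficient. If a state `x` and an input
`u` give zero output `E x + D u = 0`, then `u = K₀ x` with `K₀ = -D' E`. Let `V` be the unobservable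
subspace of the loop closed by `K₀`. Any feedback equal to `K₀` on `V` keeps `V` invariant with zero
output, so in a unitary basis adapted to `V` the system becomes block triangular. The subsystem
`(A22, B2, C2, D)` on the quotient by `V` then has no finite zero: `a x - A22 x - B2 v = 0` and `C2
x + D v = 0` force `x = 0`, `v = 0`. Outside `V` the feedback is free. Making it vanish on a
complement adapted to the flag `ker A ^ i` sends every state into `V` within `d` steps, so `A22 ^ d
= 0` (`exists_nilpotent_feedback`, `exists_decomposition`).

The eigenvalue condition. The block triangular pencil factors as `Q * T` with `det T =
A11.charpoly`. By the Smith form, `det T` is the product of the invariant polynomials exactly when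
`Q` is left invertible, that is, when the quotient subsystem has no finite zero
(`associated_charpoly_iff`). Hence absence of zeros holds for every feedback decomposition.

Factorization. Intertwining the open and closed loops gives `P = N G` (`transfer_mul_feedback`). A
kernel vector of `N(a)` with `a ≠ 0` yields a zero of the subsystem at `a⁻¹`, while `N(0) = P₀` is
injective; so `N` is left invertible (`isLeftInvertible_transfer`), which makes `G` a GCRD. The
coefficients are read off the finite Neumann series of the nilpotent matrices. -/

namespace FeedbackGCRD

/-! ### Unimodular equivalence and the Smith normal form. -/

section Smith

variable {R K R' K' R'' K'' : Type*} [Fintype R] [DecidableEq R] [Fintype K] [DecidableEq K]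
  [Fintype R'] [DecidableEq R'] [Fintype K'] [DecidableEq K']
  [Fintype R''] [DecidableEq R''] [Fintype K''] [DecidableEq K'']

/-- Unimodular equivalence of polynomial matrices, with possibly different index types. -/
def UnimodEquiv (M : Matrix R K ℂ[X]) (N : Matrix R' K' ℂ[X]) : Prop :=
  ∃ (V : Matrix R' R ℂ[X]) (V' : Matrix R R' ℂ[X]) (W : Matrix K K' ℂ[X]) (W' : Matrix K' K ℂ[X]),
    V * V' = 1 ∧ V' * V = 1 ∧ W * W' = 1 ∧ W' * W = 1 ∧ N = V * M * W

theorem UnimodEquiv.refl (M : Matrix R K ℂ[X]) : UnimodEquiv M M :=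
  ⟨1, 1, 1, 1, by simp, by simp, by simp, by simp, by simp⟩

theorem UnimodEquiv.symm {M : Matrix R K ℂ[X]} {N : Matrix R' K' ℂ[X]} (h : UnimodEquiv M N) :
    UnimodEquiv N M := by
  obtain ⟨V, V', W, W', h1, h2, h3, h4, rfl⟩ := h
  refine ⟨V', V, W', W, h2, h1, h4, h3, ?_⟩
  rw [Matrix.mul_assoc, Matrix.mul_assoc, Matrix.mul_assoc, h3, Matrix.mul_one,
    ← Matrix.mul_assoc, h2, Matrix.one_mul]

theorem UnimodEquiv.trans {M : Matrix R K ℂ[X]} {N : Matrix R' K' ℂ[X]}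
    {O : Matrix R'' K'' ℂ[X]} (h : UnimodEquiv M N) (h' : UnimodEquiv N O) : UnimodEquiv M O := by
  obtain ⟨V, V', W, W', h1, h2, h3, h4, rfl⟩ := h
  obtain ⟨Y, Y', Z, Z', g1, g2, g3, g4, rfl⟩ := h'
  refine ⟨Y * V, V' * Y', W * Z, Z' * W', ?_, ?_, ?_, ?_, ?_⟩
  · rw [Matrix.mul_assoc, ← Matrix.mul_assoc V, h1, Matrix.one_mul, g1]
  · rw [Matrix.mul_assoc, ← Matrix.mul_assoc Y', g2, Matrix.one_mul, h2]
  · rw [Matrix.mul_assoc, ← Matrix.mul_assoc Z, g3, Matrix.one_mul, h3]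
  · rw [Matrix.mul_assoc, ← Matrix.mul_assoc W', h4, Matrix.one_mul, g4]
  · simp only [Matrix.mul_assoc]

theorem UnimodEquiv.submatrix (M : Matrix R K ℂ[X]) (e : R' ≃ R) (f : K' ≃ K) :
    UnimodEquiv M (M.submatrix e f) := by
  refine ⟨(1 : Matrix R R ℂ[X]).submatrix e id, (1 : Matrix R R ℂ[X]).submatrix id e,
    (1 : Matrix K K ℂ[X]).submatrix id f, (1 : Matrix K K ℂ[X]).submatrix f id, ?_, ?_, ?_, ?_, ?_⟩
  · exact (submatrix_mul_equiv 1 1 e (Equiv.refl R) e).trans (by simp)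
  · rw [submatrix_mul_equiv]; simp
  · rw [submatrix_mul_equiv]; simp
  · exact (submatrix_mul_equiv 1 1 f (Equiv.refl K) f).trans (by simp)
  · ext i j
    simp [Matrix.mul_apply, Matrix.one_apply]

theorem UnimodEquiv.transvection_mul (M : Matrix R K ℂ[X]) {i j : R} (hij : i ≠ j) (c : ℂ[X]) :
    UnimodEquiv M (transvection i j c * M) :=
  ⟨transvection i j c, transvection i j (-c), 1, 1,
    by simp [transvection_mul_transvection_same, hij],
    by simp [transvection_mul_transvection_same, hij], by simp, by simp, by simp⟩

theorem UnimodEquiv.transpose {M : Matrix R K ℂ[X]} {N : Matrix R' K' ℂ[X]}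
    (h : UnimodEquiv M N) : UnimodEquiv Mᵀ Nᵀ := by
  obtain ⟨V, V', W, W', h1, h2, h3, h4, rfl⟩ := h
  refine ⟨Wᵀ, W'ᵀ, Vᵀ, V'ᵀ, ?_, ?_, ?_, ?_, ?_⟩
  · rw [← transpose_mul, h4, transpose_one]
  · rw [← transpose_mul, h3, transpose_one]
  · rw [← transpose_mul, h2, transpose_one]
  · rw [← transpose_mul, h1, transpose_one]
  · simp [Matrix.mul_assoc]

theorem UnimodEquiv.smul (M : Matrix R K ℂ[X]) {c : ℂ} (hc : c ≠ 0) :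
    UnimodEquiv M (C c • M) := by
  have h : (C c * C c⁻¹ : ℂ[X]) = 1 := by rw [← C_mul, mul_inv_cancel₀ hc, C_1]
  refine ⟨C c • 1, C c⁻¹ • 1, 1, 1, ?_, ?_, by simp, by simp, by simp⟩
  · rw [Matrix.smul_mul, Matrix.mul_smul, smul_smul, h, one_smul, Matrix.mul_one]
  · rw [Matrix.smul_mul, Matrix.mul_smul, smul_smul, mul_comm, h, one_smul, Matrix.mul_one]

/-- The bijections `e` and `f` serve only to make the transforming matrices square over one index
type, so that their determinants make sense. -/
theorem HasInvariantPolynomials.of_unimodEquiv {M : Matrix R K ℂ[X]} {N : Matrix R' K' ℂ[X]}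
    (e : R ≃ R') (f : K ≃ K') (h : UnimodEquiv M N) {r : ℕ} {s : Fin r → ℂ[X]}
    (hN : HasInvariantPolynomials N s) : HasInvariantPolynomials M s := by
  obtain ⟨V, V', W, W', h1, h2, h3, h4, hM⟩ := h.symm
  obtain ⟨hm, hd, a, b, Y, Z, hY, hZ, rfl⟩ := hN
  refine ⟨hm, hd, a.trans e.symm.toEmbedding, b.trans f.symm.toEmbedding,
    (V * Y).submatrix id e, (Z * W).submatrix f id, ?_, ?_, ?_⟩
  · refine isUnit_det_of_right_inverse (B := (Y⁻¹ * V').submatrix e id) ?_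
    rw [submatrix_mul_equiv, Matrix.mul_assoc, ← Matrix.mul_assoc Y, mul_nonsing_inv _ hY,
      Matrix.one_mul, h1, submatrix_id_id]
  · refine isUnit_det_of_left_inverse (B := (W' * Z⁻¹).submatrix id f) ?_
    rw [submatrix_mul_equiv, Matrix.mul_assoc, ← Matrix.mul_assoc Z⁻¹, nonsing_inv_mul _ hZ,
      Matrix.one_mul, h4, submatrix_id_id]
  · have : smithMatrix s (a.trans e.symm.toEmbedding) (b.trans f.symm.toEmbedding) =
        (smithMatrix s a b).submatrix e f := by
      ext i j
      simp [smithMatrix, Equiv.symm_apply_eq]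
    rw [this, submatrix_mul_equiv, submatrix_mul_equiv, submatrix_id_id, hM]
    simp only [Matrix.mul_assoc]

omit [Fintype R] [Fintype K] in
theorem smithMatrix_apply_embedding {r : ℕ} (s : Fin r → ℂ[X]) (a : Fin r ↪ R) (b : Fin r ↪ K)
    (t : Fin r) : smithMatrix s a b (a t) (b t) = s t := by
  simp [smithMatrix]

/-- A common divisor of the entries of a matrix divides its invariant polynomials. -/
theorem HasInvariantPolynomials.dvd {M : Matrix R K ℂ[X]} {r : ℕ} {s : Fin r → ℂ[X]}
    (h : HasInvariantPolynomials M s) {q : ℂ[X]} (hq : ∀ i j, q ∣ M i j) (t : Fin r) :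
    q ∣ s t := by
  obtain ⟨-, -, a, b, V, W, hV, hW, hM⟩ := h
  have : smithMatrix s a b = V⁻¹ * M * W⁻¹ := by
    rw [hM, ← Matrix.mul_assoc, ← Matrix.mul_assoc, nonsing_inv_mul _ hV, Matrix.one_mul,
      Matrix.mul_assoc, mul_nonsing_inv _ hW, Matrix.mul_one]
  rw [← smithMatrix_apply_embedding s a b t, this, Matrix.mul_apply]
  refine Finset.dvd_sum fun j _ => Dvd.dvd.mul_right ?_ _
  rw [Matrix.mul_apply]
  exact Finset.dvd_sum fun i _ => Dvd.dvd.mul_left (hq i j) _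

theorem HasInvariantPolynomials.fromBlocks_cons {u v : Type*} [Unique u] [Fintype u]
    [DecidableEq u] [Unique v]
    [Fintype v] [DecidableEq v] {M : Matrix R K ℂ[X]} {r : ℕ} {s : Fin r → ℂ[X]}
    (h : HasInvariantPolynomials M s) {q : ℂ[X]} (hq : ∀ i j, q ∣ M i j) (hqm : q.Monic) :
    HasInvariantPolynomials
      (fromBlocks (of fun _ _ => q) 0 0 M : Matrix (u ⊕ R) (v ⊕ K) ℂ[X])
      (Fin.cons q s : Fin (r + 1) → ℂ[X]) := by
  have hdvd := h.dvd hq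
  obtain ⟨hm, hd, a, b, V, W, hV, hW, rfl⟩ := h
  refine ⟨?_, ?_, ⟨Fin.cons (Sum.inl default) (Sum.inr ∘ a), ?_⟩,
    ⟨Fin.cons (Sum.inl default) (Sum.inr ∘ b), ?_⟩,
    fromBlocks 1 0 0 V, fromBlocks 1 0 0 W, by simpa using hV, by simpa using hW, ?_⟩
  · intro t
    cases t using Fin.cases with
    | zero => exact hqm
    | succ t => exact hm t
  · intro t t' htt
    cases t using Fin.cases with
    | zero =>
      cases t' using Fin.cases with
      | zero => exact dvd_rfl
      | succ t' => exact hdvd t'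
    | succ t =>
      cases t' using Fin.cases with
      | zero => simp at htt
      | succ t' => exact hd t t' (by simpa using htt)
  · rw [Fin.cons_injective_iff]
    exact ⟨by simp, Sum.inr_injective.comp a.injective⟩
  · rw [Fin.cons_injective_iff]
    exact ⟨by simp, Sum.inr_injective.comp b.injective⟩
  · have : smithMatrix (Fin.cons q s : Fin (r + 1) → ℂ[X])
        (⟨Fin.cons (Sum.inl default) (Sum.inr ∘ a), by
          rw [Fin.cons_injective_iff]
          exact ⟨by simp, Sum.inr_injective.comp a.injective⟩⟩ : Fin (r + 1) ↪ u ⊕ R)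
        (⟨Fin.cons (Sum.inl default) (Sum.inr ∘ b), by
          rw [Fin.cons_injective_iff]
          exact ⟨by simp, Sum.inr_injective.comp b.injective⟩⟩ : Fin (r + 1) ↪ v ⊕ K) =
        fromBlocks (of fun _ _ => q) 0 0 (smithMatrix s a b) := by
      ext i j : 2
      rcases i with i | i <;> rcases j with j | j
      · simp [smithMatrix, Fin.sum_univ_succ, Subsingleton.elim i default,
          Subsingleton.elim j default]
      all_goals simp [smithMatrix, Fin.sum_univ_succ]
    rw [this, fromBlocks_multiply, fromBlocks_multiply]
    simp

/-- Every nonzero matrix has an equivalent one with a monic entry of least degree among all the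
nonzero entries of all the equivalent matrices. -/
theorem exists_minimal_entry {M : Matrix R K ℂ[X]} (hM : M ≠ 0) :
    ∃ (N : Matrix R K ℂ[X]) (i : R) (j : K), UnimodEquiv M N ∧ (N i j).Monic ∧
      ∀ N' : Matrix R K ℂ[X], UnimodEquiv M N' → ∀ i' j', N' i' j' ≠ 0 →
        (N i j).natDegree ≤ (N' i' j').natDegree := by
  classical
  obtain ⟨i, j, hij⟩ : ∃ i j, M i j ≠ 0 := by
    by_contra! h
    exact hM (Matrix.ext h)
  have hex : ∃ δ : ℕ, ∃ (N : Matrix R K ℂ[X]) (i : R) (j : K), UnimodEquiv M N ∧ N i j ≠ 0 ∧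
      (N i j).natDegree = δ := ⟨_, M, i, j, UnimodEquiv.refl M, hij, rfl⟩
  obtain ⟨N, i, j, hN, hne, hdeg⟩ := Nat.find_spec hex
  have hlc : (N i j).leadingCoeff⁻¹ ≠ 0 := inv_ne_zero (leadingCoeff_ne_zero.2 hne)
  refine ⟨C (N i j).leadingCoeff⁻¹ • N, i, j, hN.trans (UnimodEquiv.smul N hlc), ?_, ?_⟩
  · rw [Matrix.smul_apply, smul_eq_mul, mul_comm]
    exact monic_mul_leadingCoeff_inv hne
  · intro N' hN' i' j' hne'
    rw [Matrix.smul_apply, smul_eq_mul, natDegree_C_mul hlc, hdeg]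
    exact Nat.find_min' hex ⟨N', i', j', hN', hne', rfl⟩

/-- Subtracting a multiple of the pivot row leaves the remainder of the Euclidean division as an
entry of an equivalent matrix; a nonzero remainder would have smaller degree than the pivot. -/
theorem dvd_column_of_minimal {N : Matrix R K ℂ[X]} {i : R} {j : K} (h0 : N i j ≠ 0)
    (hmin : ∀ N' : Matrix R K ℂ[X], UnimodEquiv N N' → ∀ i' j', N' i' j' ≠ 0 →
        (N i j).natDegree ≤ (N' i' j').natDegree) (i' : R) : N i j ∣ N i' j := by
  rcases eq_or_ne i' i with rfl | hi
  · exact dvd_rfl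
  · rw [← EuclideanDomain.mod_eq_zero]
    by_contra hne
    have hval : (transvection i' i (-(N i' j / N i j)) * N) i' j = N i' j % N i j := by
      rw [transvection_mul_apply_same, EuclideanDomain.mod_eq_sub_mul_div]
      ring
    have := hmin _ (UnimodEquiv.transvection_mul N hi (-(N i' j / N i j))) i' j (by rwa [hval])
    rw [hval] at this
    exact absurd (natDegree_lt_natDegree hne (EuclideanDomain.mod_lt (N i' j) h0)) (not_lt.2 this)

theorem dvd_row_of_minimal {N : Matrix R K ℂ[X]} {i : R} {j : K} (h0 : N i j ≠ 0)
    (hmin : ∀ N' : Matrix R K ℂ[X], UnimodEquiv N N' → ∀ i' j', N' i' j' ≠ 0 →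
        (N i j).natDegree ≤ (N' i' j').natDegree) (j' : K) : N i j ∣ N i j' :=
  dvd_column_of_minimal (N := Nᵀ) (i := j) (j := i) h0
    (fun N' hN' i' j' hne => hmin N'ᵀ (by simpa using hN'.transpose) j' i' hne) j'

/-- Existence of the Smith normal form. -/
theorem exists_hasInvariantPolynomials (M : Matrix R K ℂ[X]) :
    ∃ (r : ℕ) (s : Fin r → ℂ[X]), HasInvariantPolynomials M s := by
  -- Each step splits off one row and one column; the index types vary, so the induction runs on the
  -- number of rows.
  induction hc : Fintype.card R using Nat.strong_induction_on generalizing R K with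
  | _ c ih =>
  rcases eq_or_ne M 0 with rfl | hM
  · refine ⟨0, Fin.elim0, fun t => t.elim0, fun t => t.elim0, ⟨Fin.elim0, fun t => t.elim0⟩,
      ⟨Fin.elim0, fun t => t.elim0⟩, 1, 1, by simp, by simp, ?_⟩
    ext i j : 2
    simp [smithMatrix]
  · obtain ⟨N, i, j, hN, hmonic, hmin⟩ := exists_minimal_entry hM
    set q := N i j with hq
    let eR := Equiv.sumCompl fun x => x = i
    let eK := Equiv.sumCompl fun x => x = j
    -- Minimality is carried over to index types in which the pivot row and column are separated
    -- from the rest.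
    have hmin' : ∀ N' : Matrix ({x // x = i} ⊕ {x // ¬ x = i}) ({x // x = j} ⊕ {x // ¬ x = j}) ℂ[X],
        UnimodEquiv M N' → ∀ i' j', N' i' j' ≠ 0 → q.natDegree ≤ (N' i' j').natDegree := by
      intro N' hN' i' j' hne
      have := hmin (N'.submatrix eR.symm eK.symm) (hN'.trans (UnimodEquiv.submatrix _ _ _))
        (eR i') (eK j') (by simpa using hne)
      simpa using this
    set N₀ := N.submatrix eR eK with hN₀
    have hMN₀ : UnimodEquiv M N₀ := hN.trans (UnimodEquiv.submatrix _ _ _)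
    let i₀ : {x // x = i} := ⟨i, rfl⟩
    let j₀ : {x // x = j} := ⟨j, rfl⟩
    have hq₀ : N₀ (Sum.inl i₀) (Sum.inl j₀) = q := rfl
    have hcol : ∀ x, q ∣ N₀ x (Sum.inl j₀) := dvd_column_of_minimal (i := Sum.inl i₀)
      (by rw [hq₀]; exact hmonic.ne_zero) fun N' hN' => hmin' N' (hMN₀.trans hN')
    have hrow : ∀ x, q ∣ N₀ (Sum.inl i₀) x := dvd_row_of_minimal (j := Sum.inl j₀)
      (by rw [hq₀]; exact hmonic.ne_zero) fun N' hN' => hmin' N' (hMN₀.trans hN')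
    choose x hx using hcol
    choose y hy using hrow
    let xm : Matrix {x // ¬ x = i} {x // x = i} ℂ[X] := of fun a _ => x (Sum.inr a)
    let ym : Matrix {x // x = j} {x // ¬ x = j} ℂ[X] := of fun _ b => y (Sum.inr b)
    let Q : Matrix {x // x = i} {x // x = j} ℂ[X] := of fun _ _ => q
    let M' : Matrix {x // ¬ x = i} {x // ¬ x = j} ℂ[X] := N₀.toBlocks₂₂ - xm * Q * ym
    -- Block elimination: `q` divides its row and column, so both are cleared and `M'` is the Schur
    -- complement.
    have hdec : fromBlocks Q 0 0 M' =
        (fromBlocks 1 0 (-xm) 1 : Matrix _ ({x // x = i} ⊕ {x // ¬ x = i}) ℂ[X]) * N₀ *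
          (fromBlocks 1 (-ym) 0 1 : Matrix ({x // x = j} ⊕ {x // ¬ x = j}) _ ℂ[X]) := by
      have hN₀' : N₀ = fromBlocks Q (Q * ym) (xm * Q) N₀.toBlocks₂₂ := by
        ext a b : 2
        rcases a with ⟨a, rfl⟩ | a <;> rcases b with ⟨b, rfl⟩ | b
        · rfl
        · simp [Q, ym, Matrix.mul_apply, ← hy]; rfl
        · simp [Q, xm, Matrix.mul_apply, mul_comm _ q, ← hx]; rfl
        · rfl
      conv_rhs => rw [hN₀']
      rw [fromBlocks_multiply, fromBlocks_multiply]
      simp [M', Matrix.mul_assoc]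
      abel
    have hMB : UnimodEquiv M (fromBlocks Q 0 0 M') := by
      refine hMN₀.trans ⟨_, fromBlocks 1 0 xm 1, _, fromBlocks 1 ym 0 1, ?_, ?_, ?_, ?_, hdec⟩ <;>
      simp [fromBlocks_multiply]
    -- Adding row `a` of `M'` to the pivot row leaves the pivot equal to `q`, since the column below
    -- it is zero. The pivot is still minimal, hence divides the whole new row.
    have hdvd : ∀ a b, q ∣ M' a b := by
      intro a b
      have hne : (Sum.inl i₀ : {x // x = i} ⊕ {x // ¬ x = i}) ≠ Sum.inr a := by simp
      have hval : (transvection (Sum.inl i₀) (Sum.inr a) (1 : ℂ[X]) * fromBlocks Q 0 0 M')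
          (Sum.inl i₀) (Sum.inl j₀) = q := by
        rw [transvection_mul_apply_same]; simp [Q]
      have := dvd_row_of_minimal
        (N := transvection (Sum.inl i₀) (Sum.inr a) (1 : ℂ[X]) * fromBlocks Q 0 0 M') (i := Sum.inl i₀)
        (j := Sum.inl j₀) (by rw [hval]; exact hmonic.ne_zero)
        (fun N' hN' => by
          rw [hval]
          exact hmin' N' ((hMB.trans (UnimodEquiv.transvection_mul _ hne 1)).trans hN')) (Sum.inr b)
      rw [hval, transvection_mul_apply_same] at this
      simpa using this
    obtain ⟨r, s, hs⟩ := ih (Fintype.card {x // ¬ x = i})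
      (by rw [← hc]; exact Fintype.card_subtype_lt (x := i) (by simp)) M' rfl
    exact ⟨r + 1, Fin.cons q s, HasInvariantPolynomials.of_unimodEquiv eR.symm eK.symm hMB
      (hs.fromBlocks_cons hdvd hmonic)⟩

end Smith

/-! ### Left invertibility through invariant polynomials and pointwise injectivity. -/

section LeftInvertible

variable {R K : Type*} [Fintype R] [DecidableEq R] [Fintype K] [DecidableEq K]

/-- A matrix with independent columns is the product of a left invertible matrix and a square
matrix whose determinant is, up to a unit, the product of the invariant polynomials. -/
theorem HasInvariantPolynomials.exists_factorization {M : Matrix R K ℂ[X]} {r : ℕ}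
    {s : Fin r → ℂ[X]} (h : HasInvariantPolynomials M s)
    (hinj : ∀ v : K → ℂ[X], M *ᵥ v = 0 → v = 0) :
    ∃ (V : Matrix R K ℂ[X]) (E : Matrix K K ℂ[X]) (L : Matrix K R ℂ[X]),
      L * V = 1 ∧ M = V * E ∧ Associated E.det (∏ t, s t) := by
  obtain ⟨-, -, a, b, V, W, hV, hW, rfl⟩ := h
  -- A column of the Smith matrix missed by `b` is zero and would give a nonzero kernel vector of
  -- `M`.
  have hb : Function.Surjective b := by
    intro k
    by_contra! hk
    have h0 : smithMatrix s a b *ᵥ Pi.single k 1 = 0 := by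
      ext i
      simp [smithMatrix, hk]
    have h1 : W⁻¹ *ᵥ Pi.single k 1 = 0 := by
      refine hinj _ ?_
      rw [mulVec_mulVec, Matrix.mul_assoc, mul_nonsing_inv _ hW, Matrix.mul_one,
        ← mulVec_mulVec, h0, mulVec_zero]
    have h2 : (Pi.single k 1 : K → ℂ[X]) = 0 := by
      rw [← one_mulVec (Pi.single k 1), ← mul_nonsing_inv _ hW, ← mulVec_mulVec, h1, mulVec_zero]
    simpa using congrFun h2 k
  let e : Fin r ≃ K := Equiv.ofBijective b ⟨b.injective, hb⟩
  -- The columns of the identity selected by `a`: the Smith matrix is `J` times a diagonal matrix,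
  -- and `Jᵀ` is a left inverse of `J`.
  let J : Matrix R K ℂ[X] := (1 : Matrix R R ℂ[X]).submatrix id (a ∘ e.symm)
  have hJ : Jᵀ * J = 1 := by
    ext i j
    simp [J, Matrix.mul_apply, Matrix.one_apply]
  have hsm : smithMatrix s a b = J * diagonal (s ∘ e.symm) := by
    ext i j : 2
    rw [mul_diagonal]
    have hbe : ∀ t, b t = j ↔ t = e.symm j := fun t => (Equiv.eq_symm_apply e).symm
    simp only [smithMatrix, of_apply, hbe]
    rw [Finset.sum_eq_single (e.symm j)]
    · by_cases hi : a (e.symm j) = i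
      · simp [J, Matrix.one_apply, hi]
      · simp [J, hi, Ne.symm hi]
    · intro t _ ht
      simp [ht]
    · simp
  refine ⟨V * J, diagonal (s ∘ e.symm) * W, Jᵀ * V⁻¹, ?_, ?_, ?_⟩
  · rw [Matrix.mul_assoc, ← Matrix.mul_assoc V⁻¹, nonsing_inv_mul _ hV, Matrix.one_mul, hJ]
  · rw [hsm]
    simp only [Matrix.mul_assoc]
  · rw [det_mul, det_diagonal]
    have : ∏ i, (s ∘ e.symm) i = ∏ t, s t := Equiv.prod_comp e.symm s
    rw [this]
    exact associated_mul_unit_left _ _ hW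

omit [DecidableEq R] in
theorem IsLeftInvertible.eval_injective {N : Matrix R K ℂ[X]} (h : IsLeftInvertible N) (a : ℂ)
    (v : K → ℂ) (hv : N.map (evalRingHom a) *ᵥ v = 0) : v = 0 := by
  obtain ⟨L, hL⟩ := h
  have := congrArg (fun M : Matrix K K ℂ[X] => M.map (evalRingHom a)) hL
  simp only [Matrix.map_mul, Matrix.map_one _ (map_zero (evalRingHom a)) (map_one _)] at this
  rw [← one_mulVec v, ← this, ← mulVec_mulVec, hv, mulVec_zero]

/-- A polynomial matrix with independent columns at every point is left invertible. -/
theorem isLeftInvertible_of_eval_injective {N : Matrix R K ℂ[X]}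
    (h : ∀ (a : ℂ) (v : K → ℂ), N.map (evalRingHom a) *ᵥ v = 0 → v = 0) :
    IsLeftInvertible N := by
  obtain ⟨r, s, hs⟩ := exists_hasInvariantPolynomials N
  obtain ⟨V, E, L, hLV, hN, -⟩ := hs.exists_factorization (by
    intro v hv
    ext1 k
    refine Polynomial.funext fun a => ?_
    have : N.map (evalRingHom a) *ᵥ (fun k => evalRingHom a (v k)) = 0 := by
      ext i
      have := (evalRingHom a).map_mulVec N v i
      rw [hv] at this
      simpa [Function.comp_def] using this.symm
    simpa using congrFun (h a _ this) k)
  -- A root `a` of `det E` would produce a kernel vector of `E(a)`, hence of `N(a)`.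
  have hE : IsUnit E.det := by
    rw [isUnit_iff_degree_eq_zero]
    by_contra hdeg
    obtain ⟨a, ha⟩ := IsAlgClosed.exists_root E.det hdeg
    have hdet : (E.map (evalRingHom a)).det = 0 := by
      rw [← RingHom.mapMatrix_apply, ← RingHom.map_det]
      exact ha
    obtain ⟨v, hv, hEv⟩ := exists_mulVec_eq_zero_iff.2 hdet
    refine hv (h a v ?_)
    rw [hN, Matrix.map_mul, ← mulVec_mulVec, hEv, mulVec_zero]
  refine ⟨E⁻¹ * L, ?_⟩
  rw [hN, Matrix.mul_assoc, ← Matrix.mul_assoc L, hLV, Matrix.one_mul, nonsing_inv_mul _ hE]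

/-- If `M = Q T` with `T` square and nonsingular, then `Q` is left invertible if and only if the
determinant of `T` is the product of the invariant polynomials of `M`. -/
theorem HasInvariantPolynomials.isLeftInvertible_iff {M Q : Matrix R K ℂ[X]} {T : Matrix K K ℂ[X]}
    {r : ℕ} {s : Fin r → ℂ[X]} (h : HasInvariantPolynomials M s)
    (hinj : ∀ v : K → ℂ[X], M *ᵥ v = 0 → v = 0) (hM : M = Q * T) (hT : T.det ≠ 0) :
    IsLeftInvertible Q ↔ Associated T.det (∏ t, s t) := by
  obtain ⟨V, E, L, hLV, hE, hdet⟩ := h.exists_factorization hinj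
  have hET : E = L * Q * T := by
    rw [Matrix.mul_assoc, ← hM, hE, ← Matrix.mul_assoc, hLV, Matrix.one_mul]
  -- With `Q` left invertible, `E` and `T` are left multiples of each other, so their determinants
  -- divide each other. Conversely, associated determinants make `det (L * Q)` a unit after
  -- cancelling `det T`.
  constructor
  · rintro ⟨Z, hZ⟩
    have hTE : T = Z * V * E := by
      rw [Matrix.mul_assoc, ← hE, hM, ← Matrix.mul_assoc, hZ, Matrix.one_mul]
    refine Associated.trans (associated_of_dvd_dvd ⟨(L * Q).det, ?_⟩ ⟨(Z * V).det, ?_⟩) hdet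
    · rw [mul_comm, ← det_mul, ← hET]
    · rw [mul_comm, ← det_mul, ← hTE]
  · intro hassoc
    have hu : IsUnit (L * Q).det := by
      obtain ⟨u, hu⟩ := hassoc.trans hdet.symm
      have : (L * Q).det * T.det = u * T.det := by
        rw [← det_mul, ← hET, ← hu, mul_comm]
      rw [mul_right_cancel₀ hT this]
      exact u.isUnit
    exact ⟨(L * Q)⁻¹ * L, by rw [Matrix.mul_assoc, nonsing_inv_mul _ hu]⟩

end LeftInvertible

/-! ### System pencils and their finite eigenvalues. -/

section System

variable {R q p : Type*} [Fintype R] [DecidableEq R] [Fintype q] [DecidableEq q]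
  [Fintype p] [DecidableEq p]

/-- The matrix `[μ I - A, -B; C, D]`. -/
noncomputable def pencil (A : Matrix q q ℂ) (B : Matrix q p ℂ) (E : Matrix R q ℂ) (D : Matrix R p ℂ) :
    Matrix (q ⊕ R) (q ⊕ p) ℂ[X] :=
  fromBlocks (charmatrix A) (-constM B) (constM E) (constM D)

theorem charmatrix_map_eval_mulVec (A : Matrix q q ℂ) (a : ℂ) (x : q → ℂ) :
    (charmatrix A).map (evalRingHom a) *ᵥ x = a • x - A *ᵥ x := by
  have : (charmatrix A).map (evalRingHom a) = a • 1 - A := by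
    ext i j
    rcases eq_or_ne i j with rfl | hij
    · simp [charmatrix_apply_eq]
    · simp [hij]
  rw [this, sub_mulVec, smul_mulVec, one_mulVec]

omit [Fintype R] [DecidableEq R] [Fintype q] [DecidableEq q] in
theorem constM_map_eval (B : Matrix R q ℂ) (a : ℂ) : (constM B).map (evalRingHom a) = B := by
  ext; simp

-- Eliminating the input with `D'` leaves `charmatrix (A - B D' E) x = 0`, and the determinant of
-- this matrix is a monic polynomial, hence nonzero.
omit [DecidableEq R] in
theorem pencil_injective (A : Matrix q q ℂ) (B : Matrix q p ℂ) (E : Matrix R q ℂ)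
    {D : Matrix R p ℂ} {D' : Matrix p R ℂ} (hD : D' * D = 1) (v : q ⊕ p → ℂ[X])
    (hv : pencil A B E D *ᵥ v = 0) : v = 0 := by
  have hD2 : constM D' * constM D = 1 := by
    rw [← Matrix.map_mul, hD, Matrix.map_one _ (map_zero C) (map_one C)]
  have hlow : ∀ (x : q → ℂ[X]) (u : p → ℂ[X]), charmatrix A *ᵥ x - constM B *ᵥ u = 0 →
      constM E *ᵥ x + constM D *ᵥ u = 0 → x = 0 ∧ u = 0 := by
    intro x u h1 h2
    have hu : u = -(constM (D' * E) *ᵥ x) := by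
      have h3 := congrArg (constM D' *ᵥ ·) h2
      simp only [mulVec_add, mulVec_mulVec, hD2, one_mulVec, mulVec_zero] at h3
      rw [constM, Matrix.map_mul, eq_neg_iff_add_eq_zero, add_comm]
      exact h3
    have hx : charmatrix (A - B * (D' * E)) *ᵥ x = 0 := by
      have : charmatrix (A - B * (D' * E)) = charmatrix A + constM B * constM (D' * E) := by
        rw [charmatrix, charmatrix, map_sub, ← Matrix.map_mul, RingHom.mapMatrix_apply,
          RingHom.mapMatrix_apply]
        abel
      rw [this, add_mulVec, ← mulVec_mulVec, ← h1, hu, mulVec_neg, sub_neg_eq_add]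
    have hx0 : x = 0 := eq_zero_of_mulVec_eq_zero (charpoly_monic _).ne_zero hx
    exact ⟨hx0, by rw [hu, hx0, mulVec_zero, neg_zero]⟩
  rw [← Sum.elim_comp_inl_inr v, pencil, fromBlocks_mulVec] at hv
  have h1 := congrArg (· ∘ Sum.inl) hv
  have h2 := congrArg (· ∘ Sum.inr) hv
  simp only [Sum.elim_comp_inl, Sum.elim_comp_inr, neg_mulVec, ← sub_eq_add_neg] at h1 h2
  obtain ⟨hx, hu⟩ := hlow _ _ h1 h2
  rw [← Sum.elim_comp_inl_inr v, hx, hu]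
  ext (i | i) <;> rfl

variable {q₁ q₂ : Type*} [Fintype q₁] [DecidableEq q₁] [Fintype q₂] [DecidableEq q₂]

omit [Fintype R] [DecidableEq R] [Fintype p] [DecidableEq p] in
theorem pencil_fromBlocks (A11 : Matrix q₁ q₁ ℂ) (A12 : Matrix q₁ q₂ ℂ)
    (A22 : Matrix q₂ q₂ ℂ) (B1 : Matrix q₁ p ℂ) (B2 : Matrix q₂ p ℂ) (C2 : Matrix R q₂ ℂ)
    (D : Matrix R p ℂ) :
    pencil (fromBlocks A11 A12 0 A22) (fromRows B1 B2) (fromCols 0 C2) D =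
      fromBlocks (fromBlocks (charmatrix A11) (-constM A12) 0 (charmatrix A22))
        (fromRows (-constM B1) (-constM B2)) (fromCols 0 (constM C2)) (constM D) := by
  have hB : -constM (fromRows B1 B2) = fromRows (-constM B1) (-constM B2) := by
    ext (i | i) j : 2 <;> rfl
  have hC : constM (fromCols (0 : Matrix R q₁ ℂ) C2) = fromCols 0 (constM C2) := by
    ext i (j | j) : 2
    · simp
    · rfl
  rw [pencil, charmatrix_fromBlocks, hB, hC]
  simp

/-- In a block triangular system, the eigenvalues of the first diagonal block are the finite
eigenvalues of the system if and only if the complementary subsystem has no finite eigenvalue. -/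
theorem associated_charpoly_iff (A11 : Matrix q₁ q₁ ℂ) (A12 : Matrix q₁ q₂ ℂ)
    (A22 : Matrix q₂ q₂ ℂ) (B1 : Matrix q₁ p ℂ) (B2 : Matrix q₂ p ℂ) (C2 : Matrix R q₂ ℂ)
    {D : Matrix R p ℂ} {D' : Matrix p R ℂ} (hD : D' * D = 1) {r : ℕ} {s : Fin r → ℂ[X]}
    (h : HasInvariantPolynomials
      (pencil (fromBlocks A11 A12 0 A22) (fromRows B1 B2) (fromCols 0 C2) D) s) :
    (∀ (a : ℂ) (x : q₂ → ℂ) (v : p → ℂ), a • x - A22 *ᵥ x - B2 *ᵥ v = 0 →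
      C2 *ᵥ x + D *ᵥ v = 0 → x = 0 ∧ v = 0) ↔ A11.charpoly = ∏ t, s t := by
  -- The pencil equals `Q * T`: `T` carries all of `A11`, while `Q` carries only the complementary
  -- subsystem next to an identity block.
  let T : Matrix ((q₁ ⊕ q₂) ⊕ p) ((q₁ ⊕ q₂) ⊕ p) ℂ[X] :=
    fromBlocks (fromBlocks (charmatrix A11) (-constM A12) 0 1) (fromRows (-constM B1) 0) 0 1
  let Q : Matrix ((q₁ ⊕ q₂) ⊕ R) ((q₁ ⊕ q₂) ⊕ p) ℂ[X] :=
    fromBlocks (fromBlocks 1 0 0 (charmatrix A22)) (fromRows 0 (-constM B2))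
      (fromCols 0 (constM C2)) (constM D)
  have hT : T.det = A11.charpoly := by
    simp [T, charpoly]
  have hQT : pencil (fromBlocks A11 A12 0 A22) (fromRows B1 B2) (fromCols 0 C2) D = Q * T := by
    have hR : fromRows (-constM B1) 0 + fromRows 0 (-constM B2) =
        fromRows (-constM B1) (-constM B2) := by
      ext (i | i) j : 2 <;> simp
    rw [pencil_fromBlocks, fromBlocks_multiply, fromBlocks_multiply,
      fromBlocks_mul_fromRows, fromCols_mul_fromBlocks, fromCols_mul_fromRows]
    simp [hR]
  have hQ : IsLeftInvertible Q ↔ ∀ (a : ℂ) (x : q₂ → ℂ) (v : p → ℂ),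
      a • x - A22 *ᵥ x - B2 *ᵥ v = 0 → C2 *ᵥ x + D *ᵥ v = 0 → x = 0 ∧ v = 0 := by
    have hev : ∀ (a : ℂ) (x₁ : q₁ → ℂ) (x : q₂ → ℂ) (v : p → ℂ),
        Q.map (evalRingHom a) *ᵥ Sum.elim (Sum.elim x₁ x) v =
          Sum.elim (Sum.elim x₁ (a • x - A22 *ᵥ x - B2 *ᵥ v)) (C2 *ᵥ x + D *ᵥ v) := by
      intro a x₁ x v
      have h1 : (fromRows 0 (-constM B2) : Matrix (q₁ ⊕ q₂) p ℂ[X]).map (evalRingHom a) =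
          fromRows 0 (-B2) := by
        ext (i | i) j : 2 <;> simp
      have h2 : (fromCols 0 (constM C2) : Matrix R (q₁ ⊕ q₂) ℂ[X]).map (evalRingHom a) =
          fromCols 0 C2 := by
        ext i (j | j) : 2 <;> simp
      rw [fromBlocks_map, fromBlocks_map, h1, h2, constM_map_eval, fromBlocks_mulVec,
        Sum.elim_comp_inl, Sum.elim_comp_inr, fromBlocks_mulVec, fromRows_mulVec,
        fromCols_mulVec, Sum.elim_comp_inl, Sum.elim_comp_inr, charmatrix_map_eval_mulVec,
        Matrix.map_one _ (map_zero (evalRingHom a)) (map_one _)]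
      ext ((i | i) | i) <;> simp [neg_mulVec, sub_eq_add_neg]
    constructor
    · intro hL a x v h1 h2
      have := hL.eval_injective a (Sum.elim (Sum.elim 0 x) v) (by
        rw [hev, h1, h2]
        ext ((i | i) | i) <;> rfl)
      exact ⟨funext fun i => congrFun this (Sum.inl (Sum.inr i)),
        funext fun i => congrFun this (Sum.inr i)⟩
    · intro hpt
      refine isLeftInvertible_of_eval_injective fun a w hw => ?_
      rw [← Sum.elim_comp_inl_inr w, ← Sum.elim_comp_inl_inr (w ∘ Sum.inl), hev] at hw
      obtain ⟨hx, hv⟩ := hpt a _ _ (funext fun i => congrFun hw (Sum.inl (Sum.inr i)))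
        (funext fun i => congrFun hw (Sum.inr i))
      ext ((i | i) | i)
      · exact congrFun hw (Sum.inl (Sum.inl i))
      · exact congrFun hx i
      · exact congrFun hv i
  rw [← hQ, h.isLeftInvertible_iff (pencil_injective _ _ _ hD) hQT
    (by rw [hT]; exact (charpoly_monic A11).ne_zero), hT]
  constructor
  · exact eq_of_monic_of_associated (charpoly_monic A11) (monic_prod_of_monic _ _ fun t _ => h.1 t)
  · intro h'
    rw [h']

end System

/-! ### State transformations, feedback, and a constant-matrix form of the decomposition. -/

section Decomposition

variable {R q q' p : Type*} [Fintype R] [DecidableEq R] [Fintype q] [DecidableEq q]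
  [Fintype q'] [DecidableEq q'] [Fintype p] [DecidableEq p]

omit [Fintype R] [DecidableEq R] [DecidableEq q] [Fintype p] [DecidableEq p] in
theorem constM_mul (M : Matrix R q ℂ) (N : Matrix q p ℂ) :
    constM (M * N) = constM M * constM N :=
  Matrix.map_mul

omit [Fintype q] in
theorem constM_one : constM (1 : Matrix q q ℂ) = 1 :=
  Matrix.map_one _ (map_zero C) (map_one C)

omit [Fintype R] [DecidableEq R] [Fintype q] [DecidableEq q] in
theorem constM_injective : Function.Injective (constM : Matrix R q ℂ → Matrix R q ℂ[X]) :=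
  Matrix.map_injective (C_injective)

theorem charmatrix_injective :
    Function.Injective (charmatrix : Matrix q q ℂ → Matrix q q ℂ[X]) := by
  intro M N h
  apply constM_injective
  simpa [charmatrix] using h

omit [Fintype R] [DecidableEq R] [Fintype p] [DecidableEq p] in
theorem pencil_inj {A A' : Matrix q q ℂ} {B B' : Matrix q p ℂ} {E E' : Matrix R q ℂ}
    {D : Matrix R p ℂ} : pencil A B E D = pencil A' B' E' D ↔ A = A' ∧ B = B' ∧ E = E' := by
  rw [pencil, pencil, fromBlocks_inj, neg_inj, charmatrix_injective.eq_iff,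
    constM_injective.eq_iff, constM_injective.eq_iff]
  tauto

/-- The effect of a state space transformation and of a state feedback on a system. -/
theorem mul_pencil_mul (A : Matrix q q ℂ) (B : Matrix q p ℂ) (E : Matrix R q ℂ) (D : Matrix R p ℂ)
    {U : Matrix q q' ℂ} {U' : Matrix q' q ℂ} (hU : U' * U = 1) (F : Matrix p q' ℂ) :
    (fromBlocks (constM U') 0 0 1 : Matrix (q' ⊕ R) (q ⊕ R) ℂ[X]) * pencil A B E D *
        (fromBlocks (constM U) 0 (constM F) 1 : Matrix (q ⊕ p) (q' ⊕ p) ℂ[X]) =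
      pencil (U' * (A * U + B * F)) (U' * B) (E * U + D * F) D := by
  have h1 : constM U' * charmatrix A * constM U + -(constM U' * constM B * constM F) =
      charmatrix (U' * (A * U + B * F)) := by
    have h2 : constM U' * scalar q (X : ℂ[X]) * constM U = scalar q' (X : ℂ[X]) := by
      rw [← scalar_comm _ (Commute.all _), Matrix.mul_assoc, ← constM_mul, hU, constM_one,
        Matrix.mul_one]
    have h3 : constM (U' * (A * U + B * F)) =
        constM U' * constM A * constM U + constM U' * constM B * constM F := by
      rw [Matrix.mul_add, ← constM_mul, ← constM_mul, ← constM_mul, ← constM_mul,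
        Matrix.mul_assoc, Matrix.mul_assoc]
      exact Matrix.map_add _ (map_add C) _ _
    simp only [charmatrix, Matrix.mul_sub, Matrix.sub_mul, h2, RingHom.mapMatrix_apply, h3]
    abel
  rw [pencil, pencil, fromBlocks_multiply, fromBlocks_multiply, ← h1]
  simp [Matrix.map_add]

theorem unimodEquiv_pencil (A : Matrix q q ℂ) (B : Matrix q p ℂ) (E : Matrix R q ℂ)
    (D : Matrix R p ℂ) {U : Matrix q q' ℂ} {U' : Matrix q' q ℂ} (hU : U' * U = 1)
    (hU' : U * U' = 1) (F : Matrix p q' ℂ) :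
    UnimodEquiv (pencil A B E D)
      (pencil (U' * (A * U + B * F)) (U' * B) (E * U + D * F) D) := by
  have h1 : constM U' * constM U = 1 := by rw [← constM_mul, hU, constM_one]
  have h2 : constM U * constM U' = 1 := by rw [← constM_mul, hU', constM_one]
  refine ⟨_, fromBlocks (constM U) 0 0 1, _, fromBlocks (constM U') 0 (-constM (F * U')) 1,
    ?_, ?_, ?_, ?_, (mul_pencil_mul A B E D hU F).symm⟩ <;>
  simp [fromBlocks_multiply, h1, h2, Matrix.mul_assoc]

/-- A pencil determines its constant blocks, so the polynomial identity amounts to three constant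
ones; the eigenvalue condition becomes the absence of finite zeros by `associated_charpoly_iff`. -/
theorem isFeedbackDecomposition_iff {n df d0 d : ℕ} {P : Matrix R (Fin n) ℂ[X]}
    {U : Matrix (Fin d × Fin n) (Fin df ⊕ Fin d0) ℂ}
    {F : Matrix (Fin n) (Fin df ⊕ Fin d0) ℂ}
    {A11 : Matrix (Fin df) (Fin df) ℂ} {A12 : Matrix (Fin df) (Fin d0) ℂ}
    {A22 : Matrix (Fin d0) (Fin d0) ℂ}
    {B1 : Matrix (Fin df) (Fin n) ℂ} {B2 : Matrix (Fin d0) (Fin n) ℂ}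
    {C2 : Matrix R (Fin d0) ℂ} (hU : Uᴴ * U = 1) (hU' : U * Uᴴ = 1)
    {D' : Matrix (Fin n) R ℂ} (hD : D' * coeffM P 0 = 1) :
    IsFeedbackDecomposition d P U F A11 A12 A22 B1 B2 C2 ↔
      (Uᴴ * (stateA d n * U + stateB d n * F) = fromBlocks A11 A12 0 A22 ∧
        Uᴴ * stateB d n = fromRows B1 B2 ∧ stateC d P * U + coeffM P 0 * F = fromCols 0 C2) ∧
      (∀ (a : ℂ) (x : Fin d0 → ℂ) (v : Fin n → ℂ), a • x - A22 *ᵥ x - B2 *ᵥ v = 0 →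
        C2 *ᵥ x + coeffM P 0 *ᵥ v = 0 → x = 0 ∧ v = 0) ∧ IsNilpotent A22 := by
  have hdec : ((fromBlocks (constM Uᴴ) 0 0 1 :
          Matrix ((Fin df ⊕ Fin d0) ⊕ R) ((Fin d × Fin n) ⊕ R) ℂ[X]) * systemMatrix d P *
        (fromBlocks (constM U) 0 (constM F) 1 :
          Matrix ((Fin d × Fin n) ⊕ Fin n) ((Fin df ⊕ Fin d0) ⊕ Fin n) ℂ[X]) =
      fromBlocks
        (fromBlocks (charmatrix A11) (-constM A12) 0 (charmatrix A22))
        (fromRows (-constM B1) (-constM B2))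
        (fromCols 0 (constM C2))
        (constM (coeffM P 0))) ↔
      (Uᴴ * (stateA d n * U + stateB d n * F) = fromBlocks A11 A12 0 A22 ∧
        Uᴴ * stateB d n = fromRows B1 B2 ∧ stateC d P * U + coeffM P 0 * F = fromCols 0 C2) := by
    rw [← pencil_fromBlocks, ← pencil_inj (D := coeffM P 0), ← mul_pencil_mul _ _ _ _ hU]
    rfl
  have heig (h : Uᴴ * (stateA d n * U + stateB d n * F) = fromBlocks A11 A12 0 A22 ∧
        Uᴴ * stateB d n = fromRows B1 B2 ∧ stateC d P * U + coeffM P 0 * F = fromCols 0 C2) :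
      HasFiniteEigenvaluesOf A11 (systemMatrix d P) ↔
      (∀ (a : ℂ) (x : Fin d0 → ℂ) (v : Fin n → ℂ), a • x - A22 *ᵥ x - B2 *ᵥ v = 0 →
        C2 *ᵥ x + coeffM P 0 *ᵥ v = 0 → x = 0 ∧ v = 0) := by
    have hequiv := unimodEquiv_pencil (stateA d n) (stateB d n) (stateC d P) (coeffM P 0) hU hU' F
    rw [h.1, h.2.1, h.2.2] at hequiv
    -- Any bijection will do: it only relabels rows and columns.
    have e : Fin d × Fin n ≃ Fin df ⊕ Fin d0 :=
      Fintype.equivOfCardEq (square_of_invertible U Uᴴ hU' hU)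
    constructor
    · rintro ⟨r, s, hs, hprod⟩
      exact (associated_charpoly_iff A11 A12 A22 B1 B2 C2 hD (hs.of_unimodEquiv
        (e.symm.sumCongr (Equiv.refl _)) (e.symm.sumCongr (Equiv.refl _)) hequiv.symm)).2 hprod
    · intro hpt
      obtain ⟨r, s, hs⟩ := exists_hasInvariantPolynomials (systemMatrix d P)
      exact ⟨r, s, hs, (associated_charpoly_iff A11 A12 A22 B1 B2 C2 hD (hs.of_unimodEquiv
        (e.symm.sumCongr (Equiv.refl _)) (e.symm.sumCongr (Equiv.refl _)) hequiv.symm)).1 hpt⟩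
  constructor
  · intro h
    have h1 := hdec.1 h.decomp
    exact ⟨h1, (heig h1).1 h.eigenvalues, h.nilpotent⟩
  · rintro ⟨h1, h2, h3⟩
    exact ⟨hU, hU', hdec.2 h1, (heig h1).2 h2, h3⟩

end Decomposition

/-! ### Coefficient matrices. -/

section Coefficients

variable {a b : Type*}

theorem coeffM_ext {M N : Matrix a b ℂ[X]} (h : ∀ j, coeffM M j = coeffM N j) : M = N := by
  ext x y j
  exact congrFun (congrFun (h j) x) y

theorem coeffM_add (M N : Matrix a b ℂ[X]) (j : ℕ) :
    coeffM (M + N) j = coeffM M j + coeffM N j := by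
  ext; simp [coeffM]

theorem coeffM_sub (M N : Matrix a b ℂ[X]) (j : ℕ) :
    coeffM (M - N) j = coeffM M j - coeffM N j := by
  ext; simp [coeffM]

theorem coeffM_sum {ι : Type*} (s : Finset ι) (M : ι → Matrix a b ℂ[X]) (j : ℕ) :
    coeffM (∑ i ∈ s, M i) j = ∑ i ∈ s, coeffM (M i) j := by
  ext; simp [coeffM, Matrix.sum_apply]

theorem coeffM_constM_zero (M : Matrix a b ℂ) : coeffM (constM M) 0 = M := by
  ext; simp [coeffM]

theorem coeffM_constM_succ (M : Matrix a b ℂ) (j : ℕ) : coeffM (constM M) (j + 1) = 0 := by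
  ext; simp [coeffM, coeff_C_succ]

theorem coeffM_X_pow_smul_constM (M : Matrix a b ℂ) (i j : ℕ) :
    coeffM ((X : ℂ[X]) ^ i • constM M) j = if j = i then M else 0 := by
  ext
  split_ifs with h <;> simp [coeffM, coeff_X_pow, h]

end Coefficients

/-! ### Neumann series of nilpotent matrices. -/

section Resolvent

variable {R q p : Type*} [Fintype q] [DecidableEq q]

theorem isUnit_one_sub_X_smul {M : Matrix q q ℂ} (hM : IsNilpotent M) :
    IsUnit (1 - (X : ℂ[X]) • constM M).det := by
  rw [← isUnit_iff_isUnit_det]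
  refine IsNilpotent.isUnit_one_sub ?_
  have : IsNilpotent (constM M) := hM.map (C.mapMatrix)
  exact this.smul _

theorem inv_one_sub_X_smul {M : Matrix q q ℂ} {k : ℕ} (hM : M ^ k = 0) :
    (1 - (X : ℂ[X]) • constM M)⁻¹ = ∑ j ∈ Finset.range k, (X : ℂ[X]) ^ j • constM (M ^ j) := by
  apply inv_eq_right_inv
  have hpow : ∀ j, constM (M ^ j) = constM M ^ j := fun j => map_pow C.mapMatrix M j
  have h := mul_neg_geom_sum ((X : ℂ[X]) • constM M) k
  simp only [_root_.smul_pow, ← hpow, hM] at h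
  rw [h]
  simp

theorem resolvent_eq_sum {M : Matrix q q ℂ} {k : ℕ} (hM : M ^ k = 0) (L : Matrix R q ℂ)
    (B : Matrix q p ℂ) :
    constM L * (1 - (X : ℂ[X]) • constM M)⁻¹ * ((X : ℂ[X]) • constM B) =
      ∑ j ∈ Finset.range k, (X : ℂ[X]) ^ (j + 1) • constM (L * M ^ j * B) := by
  rw [inv_one_sub_X_smul hM, Matrix.mul_sum, Matrix.sum_mul]
  refine Finset.sum_congr rfl fun j _ => ?_
  rw [constM, constM, constM, constM, Matrix.map_mul, Matrix.map_mul]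
  simp [pow_succ', smul_smul]

theorem coeffM_resolvent_zero {M : Matrix q q ℂ} (hM : IsNilpotent M) (L : Matrix R q ℂ)
    (B : Matrix q p ℂ) :
    coeffM (constM L * (1 - (X : ℂ[X]) • constM M)⁻¹ * ((X : ℂ[X]) • constM B)) 0 = 0 := by
  obtain ⟨k, hk⟩ := hM
  rw [resolvent_eq_sum hk, coeffM_sum]
  exact Finset.sum_eq_zero fun j _ => by rw [coeffM_X_pow_smul_constM, if_neg (by simp)]

theorem coeffM_resolvent_succ {M : Matrix q q ℂ} (hM : IsNilpotent M) (L : Matrix R q ℂ)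
    (B : Matrix q p ℂ) (j : ℕ) :
    coeffM (constM L * (1 - (X : ℂ[X]) • constM M)⁻¹ * ((X : ℂ[X]) • constM B)) (j + 1) =
      L * M ^ j * B := by
  obtain ⟨k, hk⟩ := hM
  rw [resolvent_eq_sum hk, coeffM_sum]
  simp only [coeffM_X_pow_smul_constM, add_left_inj, Finset.sum_ite_eq, Finset.mem_range]
  split_ifs with h
  · rfl
  · rw [pow_eq_zero_of_le (not_lt.1 h) hk, Matrix.mul_zero, Matrix.zero_mul]

end Resolvent

/-! ### The block shift realization of `P`. -/

section State

variable {R : Type*} {n d : ℕ}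

theorem stateA_mul_apply {c : Type*} (M : Matrix (Fin d × Fin n) c ℂ) (x : Fin d × Fin n) (y : c) :
    (stateA d n * M) x y = if h : (x.1 : ℕ) + 1 < d then M (⟨x.1 + 1, h⟩, x.2) y else 0 := by
  rw [Matrix.mul_apply]
  split_ifs with h
  · rw [Finset.sum_eq_single (⟨x.1 + 1, h⟩, x.2)]
    · simp [stateA]
    · rintro ⟨i, k⟩ - hne
      have : ¬ ((x.1 : ℕ) + 1 = i ∧ x.2 = k) := by
        rintro ⟨h1, h2⟩
        exact hne (Prod.ext (Fin.ext h1.symm) h2.symm)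
      simp [stateA, this]
    · simp
  · refine Finset.sum_eq_zero fun z _ => ?_
    have : ¬ ((x.1 : ℕ) + 1 = z.1 ∧ x.2 = z.2) := by
      rintro ⟨h1, -⟩
      have := z.1.isLt
      omega
    simp [stateA, this]

theorem stateA_pow_apply (j : ℕ) (x y : Fin d × Fin n) :
    (stateA d n ^ j) x y = if (x.1 : ℕ) + j = (y.1 : ℕ) ∧ x.2 = y.2 then 1 else 0 := by
  induction j generalizing x with
  | zero =>
    rw [pow_zero, Matrix.one_apply]
    simp [Prod.ext_iff, Fin.ext_iff]
  | succ j ih =>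
    rw [pow_succ', stateA_mul_apply]
    have := y.1.isLt
    simp only [ih]
    grind

theorem stateA_pow_eq_zero : stateA d n ^ d = 0 := by
  ext x y
  rw [stateA_pow_apply, if_neg, Matrix.zero_apply]
  have := y.1.isLt
  omega

theorem isNilpotent_stateA : IsNilpotent (stateA d n) := ⟨d, stateA_pow_eq_zero⟩

theorem mul_stateA_pow_mul_stateB (L : Matrix R (Fin d × Fin n) ℂ) (i : Fin d) :
    L * stateA d n ^ (i : ℕ) * stateB d n = of fun x y => L x (i.rev, y) := by
  have hAB : stateA d n ^ (i : ℕ) * stateB d n =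
      (1 : Matrix (Fin d × Fin n) (Fin d × Fin n) ℂ).submatrix id fun y => (i.rev, y) := by
    ext x y
    -- `stateB` is supported on the last block, of index `d - 1`; the existence of `i : Fin d`
    -- guarantees `d > 0`. The power of the shift moves this block up to `i.rev`.
    rw [Matrix.mul_apply, Finset.sum_eq_single (⟨d - 1, by have := i.isLt; omega⟩, y)]
    · have h1 : d - 1 + 1 = d := by have := i.isLt; omega
      have h2 : (x.1 : ℕ) + i = d - 1 ↔ x.1 = i.rev := by
        rw [Fin.ext_iff, Fin.val_rev]
        omega
      simp [stateA_pow_apply, stateB, h1, h2, Matrix.one_apply, Prod.ext_iff]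
    · rintro ⟨j, k⟩ - hne
      have : ¬ ((j : ℕ) + 1 = d ∧ k = y) := by
        rintro ⟨h1, h2⟩
        exact hne (Prod.ext (Fin.ext (by simp only; omega)) h2)
      simp [stateB, this]
    · simp
  rw [Matrix.mul_assoc, hAB]
  ext x y
  simp [Matrix.mul_apply, Matrix.one_apply]

theorem mul_stateA_pow_of_le (L : Matrix R (Fin d × Fin n) ℂ) {j : ℕ} (hj : d ≤ j) :
    L * stateA d n ^ j * stateB d n = 0 := by
  rw [pow_eq_zero_of_le hj stateA_pow_eq_zero, Matrix.mul_zero, Matrix.zero_mul]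

/-- The product `C A ^ j B` selects block `d - 1 - j` of `[P_d, …, P_1]`, which is the coefficient
of index `j + 1`; the degree bound disposes of `j ≥ d`. -/
theorem eq_state_realization (P : Matrix R (Fin n) ℂ[X]) (hdeg : ∀ x y, (P x y).natDegree ≤ d) :
    P = constM (coeffM P 0) + constM (stateC d P) * (1 - (X : ℂ[X]) • constM (stateA d n))⁻¹ *
      ((X : ℂ[X]) • constM (stateB d n)) := by
  refine coeffM_ext fun j => ?_
  rw [coeffM_add]
  cases j with
  | zero => rw [coeffM_constM_zero, coeffM_resolvent_zero isNilpotent_stateA, add_zero]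
  | succ j =>
    rw [coeffM_constM_succ, coeffM_resolvent_succ isNilpotent_stateA, zero_add]
    rcases lt_or_ge j d with hj | hj
    · have := mul_stateA_pow_mul_stateB (stateC d P) ⟨j, hj⟩
      rw [this]
      ext x y
      simp only [stateC, of_apply, Fin.val_rev]
      congr 1
      omega
    · rw [mul_stateA_pow_of_le _ hj]
      ext x y
      exact coeff_eq_zero_of_natDegree_lt ((hdeg x y).trans_lt (by omega))

end State

/-! ### The factorization `P = N G` and left invertibility of `N`. -/

section Factorization

variable {R q q₂ p : Type*} [Fintype q] [DecidableEq q] [Fintype q₂] [DecidableEq q₂]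
  [Fintype p] [DecidableEq p]

/-- Here `S` and `T` stand for `1 - λ A22` and `1 - λ A`, and `B` for `λ B`; `hV` is then the
intertwining relation `V (A + B K) = A22 V` multiplied by `λ`. It telescopes the product of the two
resolvents. -/
theorem closed_loop_identity {α : Type*} [Ring α] {D : Matrix R p α} {C2 : Matrix R q₂ α}
    {S S' : Matrix q₂ q₂ α} {V : Matrix q₂ q α} {B : Matrix q p α} {K : Matrix p q α}
    {T T' : Matrix q q α} {E : Matrix R q α} (hS : S' * S = 1) (hT : T * T' = 1)
    (hV : V * B * K = V * T - S * V) (hC : E + D * K = C2 * V) :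
    (D + C2 * S' * (V * B)) * (1 - K * T' * B) = D + E * T' * B := by
  have key : C2 * S' * (V * B) * (K * T' * B) = C2 * S' * (V * B) - (E + D * K) * T' * B := by
    calc C2 * S' * (V * B) * (K * T' * B) = C2 * S' * (V * B * K) * T' * B := by
          simp only [Matrix.mul_assoc]
      _ = C2 * S' * V * (T * T') * B - C2 * (S' * S) * V * T' * B := by
          rw [hV]
          simp only [Matrix.mul_sub, Matrix.sub_mul, Matrix.mul_assoc]
      _ = C2 * S' * (V * B) - (E + D * K) * T' * B := by
          rw [hS, hT, hC, Matrix.mul_one, Matrix.mul_one, Matrix.mul_assoc _ V]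
  rw [Matrix.add_mul, Matrix.mul_sub, Matrix.mul_sub, key]
  simp only [Matrix.mul_one, Matrix.add_mul, ← Matrix.mul_assoc]
  abel

/-- The transfer function of a closed loop system, in terms of the open loop one. -/
theorem transfer_mul_feedback {A : Matrix q q ℂ} {A22 : Matrix q₂ q₂ ℂ} (hA : IsNilpotent A)
    (hA22 : IsNilpotent A22) {B : Matrix q p ℂ} {E : Matrix R q ℂ} {D : Matrix R p ℂ}
    {K : Matrix p q ℂ} {V : Matrix q₂ q ℂ} {C2 : Matrix R q₂ ℂ}
    (hV : V * (A + B * K) = A22 * V) (hC : E + D * K = C2 * V) :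
    (constM D + constM C2 * (1 - (X : ℂ[X]) • constM A22)⁻¹ * ((X : ℂ[X]) • constM (V * B))) *
      (1 - constM K * (1 - (X : ℂ[X]) • constM A)⁻¹ * ((X : ℂ[X]) • constM B)) =
    constM D + constM E * (1 - (X : ℂ[X]) • constM A)⁻¹ * ((X : ℂ[X]) • constM B) := by
  have hu := isUnit_one_sub_X_smul hA
  have hu2 := isUnit_one_sub_X_smul hA22
  have hV' : constM V * constM A + constM (V * B) * constM K = constM A22 * constM V := by
    rw [← constM_mul, ← constM_mul, ← constM_mul, ← hV, Matrix.mul_add, ← Matrix.mul_assoc]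
    exact (Matrix.map_add _ (map_add C) _ _).symm
  have hC' : constM E + constM D * constM K = constM C2 * constM V := by
    rw [← constM_mul, ← constM_mul, ← hC]
    exact (Matrix.map_add _ (map_add C) _ _).symm
  rw [constM_mul] at hV' ⊢
  rw [← Matrix.mul_smul]
  set R₁ := 1 - (X : ℂ[X]) • constM A with hR₁
  set R₂ := 1 - (X : ℂ[X]) • constM A22 with hR₂
  set XB := (X : ℂ[X]) • constM B with hXB
  refine closed_loop_identity (nonsing_inv_mul _ hu2) (mul_nonsing_inv _ hu) ?_ hC'
  rw [hXB, hR₁, hR₂, Matrix.mul_sub, Matrix.sub_mul, Matrix.mul_smul, Matrix.mul_smul,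
    Matrix.smul_mul, Matrix.smul_mul, ← hV', smul_add, Matrix.mul_one, Matrix.one_mul]
  abel

theorem X_smul_constM_map_eval {i j : Type*} (M : Matrix i j ℂ) (a : ℂ) :
    ((X : ℂ[X]) • constM M).map (evalRingHom a) = a • M := by
  ext i j
  simpa using mul_comm _ _

theorem isLeftInvertible_transfer [Fintype R] [DecidableEq R] {A22 : Matrix q₂ q₂ ℂ}
    (hA22 : IsNilpotent A22) {B2 : Matrix q₂ p ℂ} {C2 : Matrix R q₂ ℂ} {D : Matrix R p ℂ}
    {D' : Matrix p R ℂ} (hD : D' * D = 1)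
    (h : ∀ (a : ℂ) (x : q₂ → ℂ) (v : p → ℂ), a • x - A22 *ᵥ x - B2 *ᵥ v = 0 →
      C2 *ᵥ x + D *ᵥ v = 0 → x = 0 ∧ v = 0) :
    IsLeftInvertible (constM D + constM C2 * (1 - (X : ℂ[X]) • constM A22)⁻¹ *
      ((X : ℂ[X]) • constM B2)) := by
  refine isLeftInvertible_of_eval_injective fun a v hv => ?_
  have hu := isUnit_one_sub_X_smul hA22
  set S := (1 - (X : ℂ[X]) • constM A22)⁻¹ with hS
  have hres : (1 - a • A22) * S.map (evalRingHom a) = 1 := by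
    have h1 := congrArg (fun M : Matrix q₂ q₂ ℂ[X] => M.map (evalRingHom a))
      (mul_nonsing_inv _ hu)
    rwa [Matrix.map_mul, Matrix.map_sub _ (map_sub _), X_smul_constM_map_eval,
      Matrix.map_one _ (map_zero (evalRingHom a)) (map_one _)] at h1
  rw [Matrix.map_add _ (map_add _), Matrix.map_mul, Matrix.map_mul, constM_map_eval, constM_map_eval,
    X_smul_constM_map_eval, add_mulVec, ← mulVec_mulVec, ← mulVec_mulVec, smul_mulVec] at hv
  rcases eq_or_ne a 0 with rfl | ha
  · rw [zero_smul, mulVec_zero, mulVec_zero, add_zero] at hv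
    rw [← one_mulVec v, ← hD, ← mulVec_mulVec, hv, mulVec_zero]
  -- The state `x = (1 - a A22)⁻¹ a B2 v` turns a kernel vector of `N(a)` into a zero of the
  -- subsystem at `μ = a⁻¹`.
  · set x := S.map (evalRingHom a) *ᵥ (a • B2 *ᵥ v) with hx
    have h2 : x - a • A22 *ᵥ x = a • B2 *ᵥ v := by
      have : (1 - a • A22) *ᵥ x = a • B2 *ᵥ v := by
        rw [hx, mulVec_mulVec, hres, one_mulVec]
      simpa [sub_mulVec, smul_mulVec] using this
    refine (h a⁻¹ x v ?_ (by rw [add_comm]; exact hv)).2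
    apply smul_right_injective _ ha
    simp only [smul_sub, smul_smul, mul_inv_cancel₀ ha, one_smul, smul_zero]
    rw [h2, sub_self]

end Factorization

/-! ### Complements adapted to a flag. -/

section Complement

/-- A subspace has a complement adapted to a given flag. -/
theorem exists_adapted_complement {𝕜 M : Type*} [Field 𝕜] [AddCommGroup M] [Module 𝕜 M]
    (V : Submodule 𝕜 M) {Φ : ℕ → Submodule 𝕜 M} (hΦ : Monotone Φ) (h0 : Φ 0 = ⊥) (k : ℕ) :
    ∃ W : Submodule 𝕜 M, Disjoint V W ∧ W ≤ Φ k ∧ ∀ i ≤ k, Φ i ≤ V ⊔ (W ⊓ Φ i) := by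
  induction k with
  | zero =>
    refine ⟨⊥, disjoint_bot_right, bot_le, fun i hi => ?_⟩
    rw [Nat.le_zero.1 hi, h0]
    exact bot_le
  | succ k ih =>
    obtain ⟨W, hVW, hWk, hW⟩ := ih
    -- By the modular law, `E' ⊓ Φ (k + 1)` supplies exactly the part of `Φ (k + 1)` missing from `V
    -- ⊔ Φ k`.
    obtain ⟨E', hE'⟩ := exists_isCompl ((V ⊔ Φ k) ⊓ Φ (k + 1))
    have hk : Φ k ≤ Φ (k + 1) := hΦ (Nat.le_succ k)
    have hdisj : Disjoint (V ⊔ Φ k) (E' ⊓ Φ (k + 1)) := by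
      rw [disjoint_iff, inf_comm E', ← inf_assoc]
      exact hE'.inf_eq_bot
    have hsup : Φ (k + 1) ≤ (V ⊔ Φ k) ⊔ (E' ⊓ Φ (k + 1)) := by
      have h1 : Φ (k + 1) = (((V ⊔ Φ k) ⊓ Φ (k + 1)) ⊔ E') ⊓ Φ (k + 1) := by
        rw [hE'.sup_eq_top, top_inf_eq]
      rw [sup_inf_assoc_of_le E' inf_le_right] at h1
      calc Φ (k + 1) = _ := h1
        _ ≤ _ := sup_le_sup_right inf_le_left _
    refine ⟨W ⊔ (E' ⊓ Φ (k + 1)), ?_, sup_le (hWk.trans hk) inf_le_right, fun i hi => ?_⟩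
    · exact hVW.disjoint_sup_right_of_disjoint_sup_left
        (hdisj.mono_left (sup_le_sup_left hWk V))
    · rcases Nat.lt_or_ge k i with hik | hik
      · obtain rfl : i = k + 1 := by omega
        refine hsup.trans (sup_le (sup_le le_sup_left ?_) ?_)
        · exact (hW k le_rfl).trans (sup_le_sup_left (inf_le_inf le_sup_left hk) V)
        · exact le_sup_of_le_right (le_inf le_sup_right inf_le_right)
      · exact (hW i hik).trans (sup_le_sup_left (inf_le_inf_right _ le_sup_left) V)

end Complement

/-! ### Nilpotent feedback, unobservable states and unitary bases. -/

section Feedback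

variable {R q p : Type*} [Fintype q] [DecidableEq q] [Fintype p] [DecidableEq p]

omit [DecidableEq p] in
/-- A feedback that makes `V` invariant can be modified outside `V` so that the closed loop
matrix is nilpotent modulo `V`. -/
theorem exists_nilpotent_feedback {A : Matrix q q ℂ} {d : ℕ} (hA : A ^ d = 0) (B : Matrix q p ℂ)
    (K₀ : Matrix p q ℂ) (V : Submodule ℂ (q → ℂ)) (hV : ∀ x ∈ V, (A + B * K₀) *ᵥ x ∈ V) :
    ∃ K : Matrix p q ℂ, (∀ x ∈ V, K *ᵥ x = K₀ *ᵥ x) ∧ ∀ x, (A + B * K) ^ d *ᵥ x ∈ V := by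
  let Φ : ℕ → Submodule ℂ (q → ℂ) := fun i => LinearMap.ker (A ^ i).mulVecLin
  have hmem : ∀ i x, x ∈ Φ i ↔ A ^ i *ᵥ x = 0 := fun i x => by simp [Φ]
  have hΦ : Monotone Φ := by
    refine monotone_nat_of_le_succ fun i x hx => ?_
    rw [hmem] at hx ⊢
    rw [pow_succ', ← mulVec_mulVec, hx, mulVec_zero]
  have h0 : Φ 0 = ⊥ := by
    rw [eq_bot_iff]
    intro x hx
    simpa [hmem] using hx
  obtain ⟨W, hVW, -, hW⟩ := exists_adapted_complement V hΦ h0 d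
  have htop : Φ d = ⊤ := by
    rw [eq_top_iff]
    intro x _
    simp [hmem, hA]
  have hcompl : IsCompl V W := by
    refine ⟨hVW, codisjoint_iff_le_sup.2 ?_⟩
    have := hW d le_rfl
    rw [htop, inf_top_eq] at this
    exact this
  -- The projection onto `V` along `W`. The feedback `K₀ ∘ π` agrees with `K₀` on `V` and vanishes
  -- on `W`, where the closed loop therefore acts as `A`.
  let π : (q → ℂ) →ₗ[ℂ] (q → ℂ) := V.subtype ∘ₗ V.projectionOnto W hcompl
  have hπV : ∀ x ∈ V, π x = x := fun x hx => by
    have := Submodule.projectionOnto_apply_left hcompl ⟨x, hx⟩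
    simp [π, this]
  have hπW : ∀ x ∈ W, π x = 0 := fun x hx => by
    simp [π, hx]
  refine ⟨LinearMap.toMatrix' (K₀.mulVecLin ∘ₗ π), ?_, ?_⟩
  · intro x hx
    rw [LinearMap.toMatrix'_mulVec, LinearMap.comp_apply, hπV x hx, mulVecLin_apply]
  · set K := LinearMap.toMatrix' (K₀.mulVecLin ∘ₗ π) with hK
    have hKV : ∀ x ∈ V, K *ᵥ x = K₀ *ᵥ x := fun x hx => by
      rw [hK, LinearMap.toMatrix'_mulVec, LinearMap.comp_apply, hπV x hx, mulVecLin_apply]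
    have hKW : ∀ x ∈ W, K *ᵥ x = 0 := fun x hx => by
      rw [hK, LinearMap.toMatrix'_mulVec, LinearMap.comp_apply, hπW x hx, map_zero]
    -- One closed-loop step preserves `V` and maps `W ⊓ ker A ^ (i + 1)` into `ker A ^ i`, so it
    -- lowers the flag modulo `V`.
    have hstep : ∀ i ≤ d, ∀ x ∈ V ⊔ Φ i, (A + B * K) ^ i *ᵥ x ∈ V := by
      intro i
      induction i with
      | zero =>
        intro _ x hx
        rw [h0, sup_bot_eq] at hx
        simpa using hx
      | succ i ih =>
        intro hi x hx
        have hx' : x ∈ V ⊔ (W ⊓ Φ (i + 1)) :=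
          (sup_le le_sup_left (hW (i + 1) hi) : V ⊔ Φ (i + 1) ≤ _) hx
        obtain ⟨v, hv, w, ⟨hwW, hwΦ⟩, rfl⟩ := Submodule.mem_sup.1 hx'
        rw [pow_succ, ← mulVec_mulVec]
        refine ih (by omega) _ ?_
        rw [mulVec_add]
        refine Submodule.add_mem_sup ?_ ?_
        · rw [add_mulVec, ← mulVec_mulVec, hKV v hv, mulVec_mulVec, ← add_mulVec]
          exact hV v hv
        · rw [add_mulVec, ← mulVec_mulVec, hKW w hwW, mulVec_zero, add_zero]
          have := (hmem _ _).1 hwΦ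
          rw [hmem, mulVec_mulVec, ← pow_succ, this]
    intro x
    refine hstep d le_rfl x ?_
    rw [htop, sup_top_eq]
    trivial

/-- The states whose free output `E A ^ j x` vanishes at all times. -/
def unobservable (A : Matrix q q ℂ) (E : Matrix R q ℂ) : Submodule ℂ (q → ℂ) where
  carrier := {x | ∀ j : ℕ, (E * A ^ j) *ᵥ x = 0}
  add_mem' hx hy j := by rw [mulVec_add, hx j, hy j, add_zero]
  zero_mem' j := mulVec_zero _
  smul_mem' c x hx j := by rw [mulVec_smul, hx j, smul_zero]

omit [DecidableEq q] in
theorem matrix_eq_zero_of_mulVec {S : Matrix R q ℂ} (h : ∀ x, S *ᵥ x = 0) : S = 0 :=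
  mulVec_injective (funext fun x => by rw [h, zero_mulVec])

theorem mulVec_mem_unobservable {A : Matrix q q ℂ} {E : Matrix R q ℂ} {x : q → ℂ}
    (hx : x ∈ unobservable A E) : A *ᵥ x ∈ unobservable A E := fun j => by
  rw [mulVec_mulVec, Matrix.mul_assoc, ← pow_succ]
  exact hx (j + 1)

/-- An eigenvector modulo the unobservable space has free outputs with `E A ^ (j + 1) x = a E A ^ j
x`, so they all vanish with the first one. -/
theorem mem_unobservable_of_eigen {A : Matrix q q ℂ} {E : Matrix R q ℂ} {x : q → ℂ} {a : ℂ}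
    (hE : E *ᵥ x = 0) (hx : a • x - A *ᵥ x ∈ unobservable A E) : x ∈ unobservable A E := by
  intro j
  induction j with
  | zero => simpa using hE
  | succ j ih =>
    have h1 := hx j
    rw [mulVec_sub, mulVec_smul, ih, smul_zero, zero_sub, neg_eq_zero, mulVec_mulVec,
      Matrix.mul_assoc, ← pow_succ] at h1
    exact h1

/-- A unitary matrix whose first columns span a given subspace. -/
theorem exists_unitary_adapted (V : Submodule ℂ (q → ℂ)) :
    ∃ (df d0 : ℕ) (U₁ : Matrix q (Fin df) ℂ) (U₂ : Matrix q (Fin d0) ℂ),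
      (fromCols U₁ U₂)ᴴ * fromCols U₁ U₂ = 1 ∧ fromCols U₁ U₂ * (fromCols U₁ U₂)ᴴ = 1 ∧
      ∀ x, x ∈ V ↔ U₂ᴴ *ᵥ x = 0 := by
  -- `V` is moved to the Euclidean space; orthonormal bases of it and of its orthogonal complement
  -- give the columns of the unitary matrix.
  let V' : Submodule ℂ (EuclideanSpace ℂ q) :=
    V.comap (WithLp.linearEquiv 2 ℂ (q → ℂ)).toLinearMap
  let b₁ := stdOrthonormalBasis ℂ V'
  let b₂ := stdOrthonormalBasis ℂ V'ᗮ
  have hinner : ∀ x y : EuclideanSpace ℂ q, inner ℂ x y = ∑ i, star (x i) * y i := by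
    intro x y
    rw [PiLp.inner_apply]
    exact Finset.sum_congr rfl fun i _ => by simp [mul_comm]
  have hU : (fromCols (of fun x i => (b₁ i : EuclideanSpace ℂ q) x)
      (of fun x i => (b₂ i : EuclideanSpace ℂ q) x))ᴴ *
      fromCols (of fun x i => (b₁ i : EuclideanSpace ℂ q) x)
      (of fun x i => (b₂ i : EuclideanSpace ℂ q) x) = 1 := by
    have h11 := orthonormal_iff_ite.1 b₁.orthonormal
    have h22 := orthonormal_iff_ite.1 b₂.orthonormal
    ext (i | i) (j | j)
    · rw [Matrix.mul_apply]
      have := h11 i j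
      rw [Submodule.coe_inner, hinner] at this
      simpa [Matrix.one_apply] using this
    · rw [Matrix.mul_apply]
      have := V'.inner_right_of_mem_orthogonal (b₁ i).2 (b₂ j).2
      rw [hinner] at this
      simpa [Matrix.one_apply] using this
    · rw [Matrix.mul_apply]
      have := V'.inner_left_of_mem_orthogonal (b₁ j).2 (b₂ i).2
      rw [hinner] at this
      simpa [Matrix.one_apply] using this
    · rw [Matrix.mul_apply]
      have := h22 i j
      rw [Submodule.coe_inner, hinner] at this
      simpa [Matrix.one_apply] using this
  refine ⟨_, _, of fun x i => (b₁ i : EuclideanSpace ℂ q) x,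
    of fun x i => (b₂ i : EuclideanSpace ℂ q) x, hU, ?_, ?_⟩
  · refine (mul_eq_one_comm_of_card_eq _ _ _ ?_).1 hU
    rw [Fintype.card_sum, Fintype.card_fin, Fintype.card_fin,
      V'.finrank_add_finrank_orthogonal, finrank_euclideanSpace]
  · intro x
    have h1 : x ∈ V ↔ ∀ y ∈ V'ᗮ, inner ℂ y (WithLp.toLp 2 x) = 0 := by
      rw [← Submodule.mem_orthogonal, V'.orthogonal_orthogonal]
      rfl
    rw [h1]
    have h2 : ∀ i, ((of fun x i => (b₂ i : EuclideanSpace ℂ q) x)ᴴ *ᵥ x) i =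
        inner ℂ (b₂ i : EuclideanSpace ℂ q) (WithLp.toLp 2 x) := by
      intro i
      rw [hinner]
      rfl
    constructor
    · intro h
      ext i
      rw [h2]
      exact h _ (b₂ i).2
    · intro h y hy
      have h3 := congrArg (Subtype.val) (b₂.sum_repr ⟨y, hy⟩)
      simp only [Submodule.coe_sum, Submodule.coe_smul] at h3
      rw [← h3, sum_inner]
      refine Finset.sum_eq_zero fun i _ => ?_
      rw [inner_smul_left, ← h2, h, Pi.zero_apply, mul_zero]

end Feedback

/-! ### Existence of a feedback decomposition. -/

section Existence

variable {R q p : Type*} [Fintype R] [DecidableEq R] [Fintype q] [DecidableEq q]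
  [Fintype p] [DecidableEq p]

omit [DecidableEq R] in
theorem exists_decomposition {A : Matrix q q ℂ} {d : ℕ} (hA : A ^ d = 0) (B : Matrix q p ℂ)
    (E : Matrix R q ℂ) {D : Matrix R p ℂ} {D' : Matrix p R ℂ} (hD : D' * D = 1) :
    ∃ (df d0 : ℕ) (U : Matrix q (Fin df ⊕ Fin d0) ℂ) (F : Matrix p (Fin df ⊕ Fin d0) ℂ)
      (A11 : Matrix (Fin df) (Fin df) ℂ) (A12 : Matrix (Fin df) (Fin d0) ℂ)
      (A22 : Matrix (Fin d0) (Fin d0) ℂ) (B1 : Matrix (Fin df) p ℂ) (B2 : Matrix (Fin d0) p ℂ)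
      (C2 : Matrix R (Fin d0) ℂ), Uᴴ * U = 1 ∧ U * Uᴴ = 1 ∧
      (Uᴴ * (A * U + B * F) = fromBlocks A11 A12 0 A22 ∧
        Uᴴ * B = fromRows B1 B2 ∧ E * U + D * F = fromCols 0 C2) ∧
      (∀ (a : ℂ) (x : Fin d0 → ℂ) (v : p → ℂ), a • x - A22 *ᵥ x - B2 *ᵥ v = 0 →
        C2 *ᵥ x + D *ᵥ v = 0 → x = 0 ∧ v = 0) ∧ A22 ^ d = 0 := by
  set K₀ := -(D' * E) with hK₀
  set V := unobservable (A + B * K₀) (E + D * K₀) with hV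
  obtain ⟨K, hKV, hKnil⟩ := exists_nilpotent_feedback hA B K₀ V
    fun x hx => mulVec_mem_unobservable hx
  obtain ⟨df, d0, U₁, U₂, hU, hU', hmem⟩ := exists_unitary_adapted V
  set M := A + B * K with hM
  have hMV : ∀ x ∈ V, M *ᵥ x ∈ V := by
    intro x hx
    rw [hM, add_mulVec, ← mulVec_mulVec, hKV x hx, mulVec_mulVec, ← add_mulVec]
    exact mulVec_mem_unobservable hx
  have hEV : ∀ x ∈ V, (E + D * K) *ᵥ x = 0 := by
    intro x hx
    rw [add_mulVec, ← mulVec_mulVec, hKV x hx, mulVec_mulVec, ← add_mulVec]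
    simpa using hx 0
  have hUU := hU
  rw [conjTranspose_fromCols_eq_fromRows_conjTranspose, fromRows_mul_fromCols,
    ← fromBlocks_one, fromBlocks_inj] at hUU
  obtain ⟨-, -, h21, h22⟩ := hUU
  have hU₁V : ∀ x, U₁ *ᵥ x ∈ V := fun x => by
    rw [hmem, mulVec_mulVec, h21, zero_mulVec]
  have hMU : U₂ᴴ * M * U₁ = 0 := matrix_eq_zero_of_mulVec fun x => by
    rw [← mulVec_mulVec, ← mulVec_mulVec]
    exact (hmem _).1 (hMV _ (hU₁V x))
  have hEU : (E + D * K) * U₁ = 0 := matrix_eq_zero_of_mulVec fun x => by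
    rw [← mulVec_mulVec]
    exact hEV _ (hU₁V x)
  -- Invariance of `V` makes `U₂ᴴ M` factor through `U₂ᴴ`; thus `U₂ᴴ M U₂` is the map induced on the
  -- quotient by `V`, and its powers are induced by those of `M`.
  have hU₂M : U₂ᴴ * M = U₂ᴴ * M * U₂ * U₂ᴴ := by
    have h1 : U₂ᴴ * M * (fromCols U₁ U₂ * (fromCols U₁ U₂)ᴴ) = U₂ᴴ * M := by
      rw [hU', Matrix.mul_one]
    rw [conjTranspose_fromCols_eq_fromRows_conjTranspose, fromCols_mul_fromRows, Matrix.mul_add,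
      ← Matrix.mul_assoc, ← Matrix.mul_assoc, hMU, Matrix.zero_mul, zero_add] at h1
    exact h1.symm
  have hpow : ∀ T : Matrix (Fin d0) (Fin d0) ℂ, U₂ᴴ * M = T * U₂ᴴ →
      ∀ j, U₂ᴴ * M ^ j = T ^ j * U₂ᴴ := by
    intro T hT j
    induction j with
    | zero => simp
    | succ j ih =>
      rw [pow_succ, ← Matrix.mul_assoc, ih, Matrix.mul_assoc, hT, ← Matrix.mul_assoc, ← pow_succ]
  refine ⟨df, d0, fromCols U₁ U₂, K * fromCols U₁ U₂, U₁ᴴ * M * U₁, U₁ᴴ * M * U₂, U₂ᴴ * M * U₂,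
    U₁ᴴ * B, U₂ᴴ * B, (E + D * K) * U₂, hU, hU', ⟨?_, ?_, ?_⟩, ?_, ?_⟩
  · rw [← Matrix.mul_assoc B, ← Matrix.add_mul, ← hM,
      conjTranspose_fromCols_eq_fromRows_conjTranspose, mul_fromCols, fromRows_mul_fromCols, ← hMU]
    simp only [Matrix.mul_assoc]
  · rw [conjTranspose_fromCols_eq_fromRows_conjTranspose, fromRows_mul]
  · rw [← Matrix.mul_assoc D, ← Matrix.add_mul, mul_fromCols, hEU]
  -- A zero of the quotient subsystem lifts to `y = U₂ x` with input `u = K y + v` and zero output,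
  -- which forces `u = K₀ y`. Then `y` is an eigenvector modulo `V` with zero output, so `y ∈ V` and
  -- `x = U₂ᴴ y = 0`.
  · intro a x v h1 h2
    set y := U₂ *ᵥ x with hy
    have hx : U₂ᴴ *ᵥ y = x := by rw [hy, mulVec_mulVec, h22, one_mulVec]
    set u := K *ᵥ y + v with hu
    have hout : E *ᵥ y + D *ᵥ u = 0 := by
      rw [← h2, hu, mulVec_add, ← mulVec_mulVec, ← hy, add_mulVec, ← mulVec_mulVec, add_assoc]
    have huK : u = K₀ *ᵥ y := by
      have h3 := congrArg (D' *ᵥ ·) hout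
      simp only [mulVec_add, mulVec_mulVec, hD, one_mulVec, mulVec_zero] at h3
      rw [hK₀, neg_mulVec, eq_neg_iff_add_eq_zero, add_comm]
      exact h3
    have hyV : y ∈ V := by
      refine mem_unobservable_of_eigen (a := a) ?_ ?_
      · rw [add_mulVec, ← mulVec_mulVec, ← huK]
        exact hout
      · rw [← hV, hmem, add_mulVec, ← mulVec_mulVec, ← huK, ← h1, hu, mulVec_add B, mulVec_sub,
          mulVec_smul, hx, mulVec_add, mulVec_add, ← mulVec_mulVec, ← mulVec_mulVec, ← hy, hM,
          add_mulVec, mulVec_add, mulVec_mulVec v, mulVec_mulVec y B K]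
        abel
    have hx0 : x = 0 := by rw [← hx]; exact (hmem y).1 hyV
    refine ⟨hx0, ?_⟩
    rw [hx0, mulVec_zero, zero_add] at h2
    rw [← one_mulVec v, ← hD, ← mulVec_mulVec, h2, mulVec_zero]
  · refine matrix_eq_zero_of_mulVec fun x => ?_
    have : (U₂ᴴ * M * U₂) ^ d = U₂ᴴ * M ^ d * U₂ := by
      rw [hpow _ hU₂M, Matrix.mul_assoc _ U₂ᴴ, h22, Matrix.mul_one]
    rw [this, ← mulVec_mulVec, ← mulVec_mulVec]
    exact (hmem _).1 (hKnil _)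

-- The Gram matrix `Dᴴ D` has the rank of `D`, hence is invertible.
omit [DecidableEq R] in
open scoped ComplexOrder in
theorem exists_left_inverse_of_rank {n : ℕ} {D : Matrix R (Fin n) ℂ} (h : D.rank = n) :
    ∃ D' : Matrix (Fin n) R ℂ, D' * D = 1 := by
  have h1 : (Dᴴ * D).rank = n := by rw [rank_conjTranspose_mul_self, h]
  have h2 : IsUnit (Dᴴ * D) := by
    rw [← mulVec_surjective_iff_isUnit]
    have : LinearMap.range (Dᴴ * D).mulVecLin = ⊤ :=
      Submodule.eq_top_of_finrank_eq (by rw [← Matrix.rank, h1]; simp)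
    exact LinearMap.range_eq_top.1 this
  exact ⟨(Dᴴ * D)⁻¹ * Dᴴ, by
    rw [Matrix.mul_assoc, nonsing_inv_mul _ ((isUnit_iff_isUnit_det _).1 h2)]⟩

end Existence

/-! ### Coefficients of the factors, the GCRD criterion and the closed-loop relations. -/

section Factors

variable {R : Type*} {n d d0 : ℕ}

theorem coeffM_factorG_zero (K : Matrix (Fin n) (Fin d × Fin n) ℂ) :
    coeffM (factorG K) 0 = 1 := by
  rw [factorG, coeffM_sub, coeffM_resolvent_zero isNilpotent_stateA, ← constM_one,
    coeffM_constM_zero, sub_zero]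

theorem coeffM_factorG_succ (K : Matrix (Fin n) (Fin d × Fin n) ℂ) (j : ℕ) :
    coeffM (factorG K) (j + 1) = -(K * stateA d n ^ j * stateB d n) := by
  rw [factorG, coeffM_sub, coeffM_resolvent_succ isNilpotent_stateA, ← constM_one,
    coeffM_constM_succ, zero_sub]

theorem coeffM_factorN_zero (P0 : Matrix R (Fin n) ℂ) {A22 : Matrix (Fin d0) (Fin d0) ℂ}
    (hA22 : IsNilpotent A22) (B2 : Matrix (Fin d0) (Fin n) ℂ) (C2 : Matrix R (Fin d0) ℂ) :
    coeffM (factorN P0 A22 B2 C2) 0 = P0 := by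
  rw [factorN, coeffM_add, coeffM_resolvent_zero hA22, coeffM_constM_zero, add_zero]

theorem coeffM_factorN_succ (P0 : Matrix R (Fin n) ℂ) {A22 : Matrix (Fin d0) (Fin d0) ℂ}
    (hA22 : IsNilpotent A22) (B2 : Matrix (Fin d0) (Fin n) ℂ) (C2 : Matrix R (Fin d0) ℂ) (j : ℕ) :
    coeffM (factorN P0 A22 B2 C2) (j + 1) = C2 * A22 ^ j * B2 := by
  rw [factorN, coeffM_add, coeffM_resolvent_succ hA22, coeffM_constM_succ, zero_add]

/-- A right factor of a compound matrix with a left invertible cofactor is a GCRD. -/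
theorem isGCRD_of_compound_eq {k l : ℕ} {m : Fin k → ℕ}
    {P : (i : Fin k) → Matrix (Fin (m i)) (Fin n) ℂ[X]}
    {N : Matrix (Σ i, Fin (m i)) (Fin l) ℂ[X]} {G : Matrix (Fin l) (Fin n) ℂ[X]}
    (hP : compound P = N * G) (hN : IsLeftInvertible N) : IsGCRD P G := by
  refine ⟨fun i => ⟨of fun x y => N ⟨i, x⟩ y, ?_⟩, fun p Δ hΔ => ?_⟩
  · ext x y : 1
    have := congrFun (congrFun hP ⟨i, x⟩) y
    rw [Matrix.mul_apply] at this ⊢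
    exact this
  · obtain ⟨L, hL⟩ := hN
    choose Q hQ using hΔ
    let Q' : Matrix (Σ i, Fin (m i)) (Fin p) ℂ[X] := of fun x y => Q x.1 x.2 y
    have hcomp : compound P = Q' * Δ := by
      ext x y : 1
      have := congrFun (congrFun (hQ x.1) x.2) y
      rw [Matrix.mul_apply] at this ⊢
      exact this
    refine ⟨L * Q', ?_⟩
    rw [Matrix.mul_assoc, ← hcomp, hP, ← Matrix.mul_assoc, hL, Matrix.one_mul]

/-- The closed loop relations satisfied by a feedback decomposition, in the original state
coordinates. -/
theorem closed_loop_relations {df : ℕ}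
    {A : Matrix (Fin d × Fin n) (Fin d × Fin n) ℂ} {B : Matrix (Fin d × Fin n) (Fin n) ℂ}
    {E : Matrix R (Fin d × Fin n) ℂ} {D : Matrix R (Fin n) ℂ}
    {U : Matrix (Fin d × Fin n) (Fin df ⊕ Fin d0) ℂ}
    {F : Matrix (Fin n) (Fin df ⊕ Fin d0) ℂ}
    {A11 : Matrix (Fin df) (Fin df) ℂ} {A12 : Matrix (Fin df) (Fin d0) ℂ}
    {A22 : Matrix (Fin d0) (Fin d0) ℂ}
    {B1 : Matrix (Fin df) (Fin n) ℂ} {B2 : Matrix (Fin d0) (Fin n) ℂ}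
    {C2 : Matrix R (Fin d0) ℂ} (hU' : U * Uᴴ = 1)
    (hA : Uᴴ * (A * U + B * F) = fromBlocks A11 A12 0 A22) (hB : Uᴴ * B = fromRows B1 B2)
    (hC : E * U + D * F = fromCols 0 C2) :
    Uᴴ.toRows₂ * (A + B * (F * Uᴴ)) = A22 * Uᴴ.toRows₂ ∧ B2 = Uᴴ.toRows₂ * B ∧
      E + D * (F * Uᴴ) = C2 * Uᴴ.toRows₂ := by
  have hrows : ∀ {c : Type} (M : Matrix (Fin d × Fin n) c ℂ),
      Uᴴ.toRows₂ * M = (Uᴴ * M).toRows₂ := fun M => rfl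
  refine ⟨?_, ?_, ?_⟩
  · have h1 : Uᴴ * (A + B * (F * Uᴴ)) = Uᴴ * (A * U + B * F) * Uᴴ := by
      rw [Matrix.mul_assoc, Matrix.add_mul, Matrix.mul_assoc A, hU', Matrix.mul_one,
        Matrix.mul_assoc B]
    rw [hrows, h1, hA]
    conv_lhs => rw [← fromRows_toRows Uᴴ]
    rw [fromBlocks_mul_fromRows, toRows₂_fromRows, Matrix.zero_mul, zero_add]
  · rw [hrows, hB, toRows₂_fromRows]
  · have h1 : E + D * (F * Uᴴ) = (E * U + D * F) * Uᴴ := by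
      rw [Matrix.add_mul, Matrix.mul_assoc E, hU', Matrix.mul_one, Matrix.mul_assoc D]
    rw [h1, hC]
    conv_lhs => rw [← fromRows_toRows Uᴴ]
    rw [fromCols_mul_fromRows, Matrix.zero_mul, zero_add]

end Factors

end FeedbackGCRD

/-! ### The main theorem. -/

open FeedbackGCRD
theorem mainTheorem10 (k n d : ℕ) (m : Fin k → ℕ)
    (P : (i : Fin k) → Matrix (Fin (m i)) (Fin n) ℂ[X])
    (hdeg : ∀ i x y, (P i x y).natDegree ≤ d)
    (hrank : (coeffM (compound P) 0).rank = n) :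
    (∃ (df d0 : ℕ) (U : Matrix (Fin d × Fin n) (Fin df ⊕ Fin d0) ℂ)
      (F : Matrix (Fin n) (Fin df ⊕ Fin d0) ℂ)
      (A11 : Matrix (Fin df) (Fin df) ℂ) (A12 : Matrix (Fin df) (Fin d0) ℂ)
      (A22 : Matrix (Fin d0) (Fin d0) ℂ)
      (B1 : Matrix (Fin df) (Fin n) ℂ) (B2 : Matrix (Fin d0) (Fin n) ℂ)
      (C2 : Matrix (Σ i, Fin (m i)) (Fin d0) ℂ),
      IsFeedbackDecomposition d (compound P) U F A11 A12 A22 B1 B2 C2 ∧ A22 ^ d = 0) ∧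
    (∀ (df d0 : ℕ) (U : Matrix (Fin d × Fin n) (Fin df ⊕ Fin d0) ℂ)
      (F : Matrix (Fin n) (Fin df ⊕ Fin d0) ℂ)
      (A11 : Matrix (Fin df) (Fin df) ℂ) (A12 : Matrix (Fin df) (Fin d0) ℂ)
      (A22 : Matrix (Fin d0) (Fin d0) ℂ)
      (B1 : Matrix (Fin df) (Fin n) ℂ) (B2 : Matrix (Fin d0) (Fin n) ℂ)
      (C2 : Matrix (Σ i, Fin (m i)) (Fin d0) ℂ),
      IsFeedbackDecomposition d (compound P) U F A11 A12 A22 B1 B2 C2 →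
      -- the inverses in the formulas for `N` and `G` exist over the polynomials
      IsUnit (1 - (X : ℂ[X]) • constM A22).det ∧
      IsUnit (1 - (X : ℂ[X]) • constM (stateA d n)).det ∧
      compound P = factorN (coeffM (compound P) 0) A22 B2 C2 * factorG (F * Uᴴ) ∧
      IsLeftInvertible (factorN (coeffM (compound P) 0) A22 B2 C2) ∧
      IsGCRD P (factorG (F * Uᴴ)) ∧
      -- coefficients of `G`
      coeffM (factorG (F * Uᴴ)) 0 = 1 ∧
      (∀ i : Fin d, coeffM (factorG (F * Uᴴ)) (i + 1) = -feedbackBlock (F * Uᴴ) i) ∧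
      (∀ j, d < j → coeffM (factorG (F * Uᴴ)) j = 0) ∧
      -- coefficients of `N`
      coeffM (factorN (coeffM (compound P) 0) A22 B2 C2) 0 = coeffM (compound P) 0 ∧
      (∀ j, coeffM (factorN (coeffM (compound P) 0) A22 B2 C2) (j + 1) = C2 * A22 ^ j * B2) ∧
      (A22 ^ d = 0 →
        ∀ j, d < j → coeffM (factorN (coeffM (compound P) 0) A22 B2 C2) j = 0)) := by
  obtain ⟨D', hD⟩ := exists_left_inverse_of_rank hrank
  refine ⟨?_, ?_⟩
  · obtain ⟨df, d0, U, F, A11, A12, A22, B1, B2, C2, hU, hU', hdec, hpt, hnil⟩ :=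
      exists_decomposition (stateA_pow_eq_zero (d := d) (n := n)) (stateB d n)
        (stateC d (compound P)) hD
    exact ⟨df, d0, U, F, A11, A12, A22, B1, B2, C2,
      (isFeedbackDecomposition_iff hU hU' hD).2 ⟨hdec, hpt, d, hnil⟩, hnil⟩
  · intro df d0 U F A11 A12 A22 B1 B2 C2 h
    obtain ⟨⟨hA, hB, hC⟩, hpt, hnil⟩ :=
      (isFeedbackDecomposition_iff h.unitary_left h.unitary_right hD).1 h
    obtain ⟨hV, hB2, hC2⟩ := closed_loop_relations h.unitary_right hA hB hC
    have hPNG : compound P =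
        factorN (coeffM (compound P) 0) A22 B2 C2 * factorG (F * Uᴴ) := by
      rw [factorN, factorG, hB2, transfer_mul_feedback isNilpotent_stateA hnil hV hC2]
      exact eq_state_realization _ fun x y => hdeg x.1 x.2 y
    have hN : IsLeftInvertible (factorN (coeffM (compound P) 0) A22 B2 C2) :=
      isLeftInvertible_transfer hnil hD hpt
    refine ⟨isUnit_one_sub_X_smul hnil, isUnit_one_sub_X_smul isNilpotent_stateA, hPNG, hN,
      isGCRD_of_compound_eq hPNG hN, coeffM_factorG_zero _, fun i => ?_, fun j hj => ?_,
      coeffM_factorN_zero _ hnil _ _, coeffM_factorN_succ _ hnil _ _, fun hd j hj => ?_⟩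
    · rw [coeffM_factorG_succ, mul_stateA_pow_mul_stateB]
      rfl
    · obtain ⟨j, rfl⟩ : ∃ i, j = i + 1 := ⟨j - 1, by omega⟩
      rw [coeffM_factorG_succ, mul_stateA_pow_of_le _ (by omega), neg_zero]
    · obtain ⟨j, rfl⟩ : ∃ i, j = i + 1 := ⟨j - 1, by omega⟩
      rw [coeffM_factorN_succ _ hnil, pow_eq_zero_of_le (by omega) hd, Matrix.mul_zero,
        Matrix.zero_mul]
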